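/- Let $m\ge 1$ and let $\boldsymbol n=(n_1,\dots,n_m)$ be nonnegative integers, $N=n_1+\cdots+n_m$; cut $\{1,\dots,N\}$ into consecutive boxes $S_1,\dots,S_m$ with $|S_j|=n_j$. A set partition of $\{1,\dots,N\}$ is \emph{inhomogeneous} if each block has at least two elements and no two elements of a block lie in the same box; let $\mathcal P(\boldsymbol n)$ be the set of these. For a set partition $\pi$ let $\mathrm{bl}(\pi)$ be the number of blocks, $\mathrm{sg}(\pi)$ the number of blocks of size one, $\mathrm{tr}(\pi)$ the number of elements that are neither the least nor the greatest element of their block, and $\mathrm{cr}(\pi)$ the number of pairs of arcs $(i,j),(k,\ell)$ with $i<k<j<\ell$, an arc being a pair $i<j$ of successive elements of a block. Put $$\mathcal F(\boldsymbol n|q)=\sum_{\pi\in\mathcal P(\boldsymbol n)}a^{\mathrm{bl}(\pi)}b^{\mathrm{tr}(\pi)}c^{\mathrm{sg}(\pi)}q^{\mathrm{cr}(\pi)}$$ (here $\mathrm{sg}(\pi)=0$ for every $\pi\in\mathcal P(\boldsymbol n)$). With $[n]_q=1+q+\cdots+q^{n-1}$, the $q$-Charlier polynomials $C_n(x|q)=C_n(x,a,b,c|q)$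 are defined by $C_{-1}(x|q)=0$, $C_0(x|q)=1$ and $$C_{n+1}(x|q)=(x-c-b[n]_q)\,C_n(x|q)-a[n]_q\,C_{n-1}(x|q)\qquad(n\ge 0).$$ (i) Let $R$ be a commutative ring and $a,b,c,q\in R$. There is exactly one $R$-linear functional $\mathcal L:R[x]\to R$ with $\mathcal L(1)=1$ and $\mathcal L(C_iC_j)=0$ for all $i\ne j$, and it satisfies $$\mathcal F(\boldsymbol n|q)=\mathcal L\bigl(C_{n_1}(x|q)\cdots C_{n_m}(x|q)\bigr).$$ (ii) Let $a,b,c,q$ be real with $a>0$, $-1<q<1$ and $b^2\le a(1-q)$. Then $$\mathcal F(\boldsymbol n|q)=\mathcal L_1\bigl(C_{n_1}(x|q)\cdots C_{n_m}(x|q)\bigr),$$ where $$\mathcal L_1(f)=\frac{(q;q)_\infty}{2\pi}\,\frac12\sqrt{\frac{1-q}{a}}\int_{A_-}^{A_+}f(x)\prod_{k=0}^\infty\frac{1-2u_1(x)q^k+q^{2k}}{1+2b\,v_1(x)q^k/\sqrt{a(1-q)}+b^2q^{2k}/(a(1-q))}\,\frac{dx}{\sqrt{1-v_1(x)^2}},$$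 $$(q;q)_\infty=\prod_{k\ge1}(1-q^k),\qquad A_\pm=c+\frac b{1-q}\pm2\sqrt{\frac a{1-q}},\qquad v_1(x)=\frac12\sqrt{\frac{1-q}{a}}\Bigl(x-c-\frac b{1-q}\Bigr),$$ $$u_1(x)=\frac{1-q}{2a}x^2-\frac{c(1-q)+b}{a}x+\frac{b^2+c^2(1-q)^2+2(1-q)(bc-a)}{2a(1-q)},$$ and for every polynomial $f$ the integral converges absolutely. -/

import Mathlib

open scoped BigOperators

/-! ### Set partitions of `{0, …, N - 1}` and their statistics -/

namespace QCharlier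

/-- A set partition of the `N`-element ordered set `Fin N`. -/
abbrev SetPartition (N : ℕ) : Type := Finpartition (Finset.univ : Finset (Fin N))

/-- `i < j` are successive elements of a block of `π`: the pair `(i, j)` is an arc of `π`. -/
def IsArc {N : ℕ} (π : SetPartition N) (i j : Fin N) : Prop :=
  i < j ∧ ∃ B ∈ π.parts, i ∈ B ∧ j ∈ B ∧ ∀ p ∈ B, ¬ (i < p ∧ p < j)

instance {N : ℕ} (π : SetPartition N) (i j : Fin N) : Decidable (IsArc π i j) := by
  unfold IsArc; infer_instance

/-- The number of blocks. -/
def bl {N : ℕ} (π : SetPartition N) : ℕ := π.parts.card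

/-- The number of singletons, i.e. blocks of size one. -/
def sg {N : ℕ} (π : SetPartition N) : ℕ := (π.parts.filter fun B => B.card = 1).card

/-- The number of transients: elements that are neither the least nor the greatest element of
their block. -/
def tr {N : ℕ} (π : SetPartition N) : ℕ :=
  (Finset.univ.filter fun x : Fin N =>
    ∃ B ∈ π.parts, x ∈ B ∧ (∃ y ∈ B, y < x) ∧ (∃ z ∈ B, x < z)).card

/-- The number of arc crossings: pairs of arcs `(i, j)`, `(k, l)` with `i < k < j < l`. -/
def cr {N : ℕ} (π : SetPartition N) : ℕ :=
  (Finset.univ.filter fun e : (Fin N × Fin N) × (Fin N × Fin N) =>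
    IsArc π e.1.1 e.1.2 ∧ IsArc π e.2.1 e.2.2 ∧
      e.1.1 < e.2.1 ∧ e.2.1 < e.1.2 ∧ e.1.2 < e.2.2).card

/-- The weight `a ^ bl * b ^ tr * c ^ sg * q ^ cr` of a set partition. -/
def weight {R : Type*} [CommRing R] (a b c q : R) {N : ℕ} (π : SetPartition N) : R :=
  a ^ bl π * b ^ tr π * c ^ sg π * q ^ cr π

/-! ### Boxes and inhomogeneous partitions -/

/-- The `j`-th box: `n_1 + ⋯ + n_m` elements are cut into consecutive boxes of sizes
`n_1, …, n_m` (all indices start at zero). -/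
def box {m : ℕ} (n : Fin m → ℕ) (j : Fin m) : Finset (Fin (∑ i, n i)) :=
  Finset.univ.filter fun x =>
    ∑ i ∈ Finset.Iio j, n i ≤ (x : ℕ) ∧ (x : ℕ) < ∑ i ∈ Finset.Iic j, n i

/-- Every block has at least two elements, and no two elements of a block share a box. -/
def IsInhomogeneous {m : ℕ} (n : Fin m → ℕ) (π : SetPartition (∑ i, n i)) : Prop :=
  ∀ B ∈ π.parts, 2 ≤ B.card ∧
    ∀ x ∈ B, ∀ y ∈ B, x ≠ y → ∀ j, ¬ (x ∈ box n j ∧ y ∈ box n j)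

instance {m : ℕ} (n : Fin m → ℕ) : DecidablePred (IsInhomogeneous n) := fun π => by
  unfold IsInhomogeneous; infer_instance

/-- The enumerative polynomial `F(n; a, b, c | q)` of inhomogeneous partitions. -/
def F {R : Type*} [CommRing R] (a b c q : R) {m : ℕ} (n : Fin m → ℕ) : R :=
  ∑ π : SetPartition (∑ i, n i) with IsInhomogeneous n π, weight a b c q π

/-! ### `q`-Charlier polynomials -/

/-- The `q`-integer `[n]_q = 1 + q + ⋯ + q ^ (n - 1)`. -/
def qInt {R : Type*} [CommRing R] (q : R) (n : ℕ) : R := ∑ i ∈ Finset.range n, q ^ i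

/-- The `q`-Charlier polynomials:
`C_{n+1} = (x - c - b [n]_q) C_n - a [n]_q C_{n-1}`, `C_0 = 1`, `C_{-1} = 0`. -/
noncomputable def charlier {R : Type*} [CommRing R] (a b c q : R) : ℕ → Polynomial R
  | 0 => 1
  | 1 => Polynomial.X - Polynomial.C c
  | n + 2 =>
      (Polynomial.X - Polynomial.C c - Polynomial.C (b * qInt q (n + 1)))
          * charlier a b c q (n + 1)
        - Polynomial.C (a * qInt q (n + 1)) * charlier a b c q n

/-- `L` is the (normalized) linear functional for which the `q`-Charlier polynomials are
orthogonal. -/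
def IsOrthogonalityFunctional {R : Type*} [CommRing R] (a b c q : R)
    (L : Polynomial R →ₗ[R] R) : Prop :=
  L 1 = 1 ∧ ∀ i j : ℕ, i ≠ j → L (charlier a b c q i * charlier a b c q j) = 0

/-! ### The integral form of the functional -/

/-- `(q; q)_∞`. -/
noncomputable def qPochInf (q : ℝ) : ℝ := ∏' k : ℕ, (1 - q ^ (k + 1))

/-- The quadratic polynomial `u_1`. -/
noncomputable def u₁ (a b c q x : ℝ) : ℝ :=
  (1 - q) / (2 * a) * x ^ 2 - (c * (1 - q) + b) / a * x
    + (b ^ 2 + c ^ 2 * (1 - q) ^ 2 + 2 * (1 - q) * (b * c - a)) / (2 * a * (1 - q))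

/-- The affine function `v_1`. -/
noncomputable def v₁ (a b c q x : ℝ) : ℝ :=
  1 / 2 * √((1 - q) / a) * (x - c - b / (1 - q))

/-- The density of the orthogonality measure of the `q`-Charlier polynomials. -/
noncomputable def density (a b c q x : ℝ) : ℝ :=
  qPochInf q / (2 * Real.pi) * (1 / 2) * √((1 - q) / a)
    * (∏' k : ℕ, (1 - 2 * u₁ a b c q x * q ^ k + q ^ (2 * k))
        / (1 + 2 * b * v₁ a b c q x * q ^ k / √(a * (1 - q))
            + b ^ 2 * q ^ (2 * k) / (a * (1 - q))))
    / √(1 - v₁ a b c q x ^ 2)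

/-- The left end `A₋` of the support. -/
noncomputable def Aminus (a b c q : ℝ) : ℝ := c + b / (1 - q) - 2 * √(a / (1 - q))

/-- The right end `A₊` of the support. -/
noncomputable def Aplus (a b c q : ℝ) : ℝ := c + b / (1 - q) + 2 * √(a / (1 - q))

/-- The functional `L_1`, as an integral over `[A₋, A₊]`. -/
noncomputable def L₁ (a b c q : ℝ) (f : ℝ → ℝ) : ℝ :=
  ∫ x in (Aminus a b c q)..(Aplus a b c q), f x * density a b c q x

end QCharlier

/-! A partition is read from left to right as a history: every element records its predecessor in
its block and whether it has a successor. An element is open while its outgoing arc has not yet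
ended. The weight is a product over the steps: a block end gives `a`, a transient gives `b`, and an
arc ending at `j` crosses exactly the arcs that start after its left end and are still open at `j`.
Inhomogeneity is also local: the chosen predecessor must lie before the current box.

For (i), the total weight of all continuations depends only on the number of open elements. With
open set `O` at the start of a box it is `L` applied to `charlier O.card` times the polynomials of
the remaining boxes (`transfer_boxStart`). This is proved backwards. After the last box it says that
`L` sends `C_k` to 1 for `k = 0` and to 0 otherwise; passing a box is the linearization formula for
`C_n * C_h` (`boxPoly_eq_mul`), because choosing among `h` old arcs, with `k` newer ones open,
contributes `q ^ k * [h]_q`. The functional itself exists and is unique because the `C_n` form a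
basis of `R[x]`: it reads off the coefficient of `C_0`.

For (ii), by (i) it suffices that the integral sends `C_n` to 1 for `n = 0` and to 0 otherwise. An
affine substitution turns `C_n` into a multiple of the continuous big `q`-Hermite polynomial in `2
cos θ` with parameter `β = -b / √(a (1 - q))`, and `b ^ 2 ≤ a (1 - q)` says `|β| ≤ 1`. For `β = 0`
the Fourier coefficients of the weight come from a finite form of the Jacobi triple product, and the
`q`-binomial theorem then gives orthogonality of the `q`-Hermite polynomials `H_j`. For `|β| < 1`
the weight is multiplied by the generating function of the `H_n`, so the integral of `H_j` becomes
`β ^ j`; this extends to `|β| = 1` by continuity. Those values already force the big `q`-Hermite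
polynomials of positive degree to integrate to zero (`apply_bigQHermite`). -/

namespace QCharlier

/-! ### The orthogonality functional and the linearization of products. -/

section Algebra

variable {R : Type*} [CommRing R] (a b c q : R)

@[simp] lemma qInt_zero : qInt q 0 = 0 := by simp [qInt]

lemma qInt_succ (n : ℕ) : qInt q (n + 1) = qInt q n + q ^ n := by
  simp [qInt, Finset.sum_range_succ]

lemma qInt_succ' (n : ℕ) : qInt q (n + 1) = 1 + q * qInt q n := by
  simp [qInt, Finset.sum_range_succ', Finset.mul_sum, pow_succ', add_comm]

lemma qInt_add (h k : ℕ) : qInt q (h + k) = qInt q k + q ^ k * qInt q h := by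
  induction h with
  | zero => simp
  | succ h ih =>
    rw [Nat.add_right_comm, qInt_succ, ih, qInt_succ, pow_add]
    ring

lemma one_sub_mul_qInt (n : ℕ) : (1 - q) * qInt q n = 1 - q ^ n := by
  induction n with
  | zero => simp
  | succ n ih => rw [qInt_succ, mul_add, ih]; ring

/-- The three-term recurrence, solved for `x C_n`; the last term vanishes for `n = 0`. -/
lemma X_mul_charlier (n : ℕ) :
    Polynomial.X * charlier a b c q n = charlier a b c q (n + 1)
      + Polynomial.C (c + b * qInt q n) * charlier a b c q n
      + Polynomial.C (a * qInt q n) * charlier a b c q (n - 1) := by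
  cases n with
  | zero => simp [charlier]
  | succ n =>
    rw [charlier]
    simp only [Nat.add_sub_cancel, Polynomial.C_add]
    ring

/-- The span contains `C_0 = 1` and, by the recurrence, is stable under multiplication by `x`. -/
lemma span_charlier : Submodule.span R (Set.range (charlier a b c q)) = ⊤ := by
  set S := Submodule.span R (Set.range (charlier a b c q)) with hS
  have hmem : ∀ n, charlier a b c q n ∈ S := fun n => Submodule.subset_span ⟨n, rfl⟩
  have hX : ∀ p ∈ S, Polynomial.X * p ∈ S := by
    intro p hp
    induction hp using Submodule.span_induction with
    | mem p hp =>
      obtain ⟨n, rfl⟩ := hp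
      rw [X_mul_charlier]
      simp only [← Polynomial.smul_eq_C_mul]
      exact S.add_mem (S.add_mem (hmem _) (S.smul_mem _ (hmem _))) (S.smul_mem _ (hmem _))
    | zero => simp
    | add p r _ _ hp hr => rw [mul_add]; exact S.add_mem hp hr
    | smul t p _ hp => rw [mul_smul_comm]; exact S.smul_mem _ hp
  rw [eq_top_iff]
  rintro p -
  induction p using Polynomial.induction_on' with
  | add p r hp hr => exact S.add_mem hp hr
  | monomial n t =>
    rw [← Polynomial.C_mul_X_pow_eq_monomial, ← Polynomial.smul_eq_C_mul]
    refine S.smul_mem _ ?_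
    induction n with
    | zero => exact hmem 0
    | succ n ih => rw [pow_succ']; exact hX _ ih

/-- Multiplication by `x` in the basis of the `q`-Charlier polynomials. -/
noncomputable def jacobiOperator : (ℕ →₀ R) →ₗ[R] (ℕ →₀ R) :=
  Finsupp.linearCombination R fun n => Finsupp.single (n + 1) 1
    + (c + b * qInt q n) • Finsupp.single n 1 + (a * qInt q n) • Finsupp.single (n - 1) 1

/-- This realizes `R[x]` on sequences with `C_n` as the `n`-th basis vector, so coordinates with
respect to the `C_n` are available over any commutative ring. -/
lemma aeval_jacobiOperator_charlier (n : ℕ) :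
    Polynomial.aeval (jacobiOperator a b c q) (charlier a b c q n) (Finsupp.single 0 1)
      = Finsupp.single n 1 := by
  have key : ∀ n, jacobiOperator a b c q (Finsupp.single n 1) = Finsupp.single (n + 1) 1
      + (c + b * qInt q n) • Finsupp.single n 1
      + (a * qInt q n) • Finsupp.single (n - 1) 1 := by
    intro n; simp [jacobiOperator]
  induction n using Nat.strong_induction_on with
  | _ n ih =>
    match n with
    | 0 => simp [charlier]
    | n + 1 =>
      have h := congrArg (fun p => Polynomial.aeval (jacobiOperator a b c q) p
        (Finsupp.single 0 1)) (X_mul_charlier a b c q n)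
      simp only [map_add, map_mul, Polynomial.aeval_X, Polynomial.aeval_C, Module.End.mul_apply,
        LinearMap.add_apply, Module.algebraMap_end_apply, ih n (by omega),
        ih (n - 1) (by omega), key] at h
      simpa using h.symm

/-- The coefficient of `C_0` in the expansion of a polynomial in `q`-Charlier polynomials. -/
noncomputable def orthogonalityFunctional : Polynomial R →ₗ[R] R :=
  Finsupp.lapply 0 ∘ₗ LinearMap.applyₗ (Finsupp.single 0 1)
    ∘ₗ (Polynomial.aeval (jacobiOperator a b c q)).toLinearMap

lemma orthogonalityFunctional_charlier (n : ℕ) :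
    orthogonalityFunctional a b c q (charlier a b c q n) = if n = 0 then 1 else 0 := by
  have := aeval_jacobiOperator_charlier a b c q n
  simp [orthogonalityFunctional, this, Finsupp.single_apply]

variable {a b c q}

lemma IsOrthogonalityFunctional.apply_charlier {L : Polynomial R →ₗ[R] R}
    (hL : IsOrthogonalityFunctional a b c q L) (n : ℕ) :
    L (charlier a b c q n) = if n = 0 then 1 else 0 := by
  split_ifs with h
  · subst h; exact hL.1
  · have := hL.2 n 0 h
    simpa [charlier] using this

/-- Moving one factor `x` from `C_(j+1)` to `C_i` expresses `C_i C_(j+1)` by products whose second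
index is at most `j` and still below the first index; the induction ends at `C_i C_0`. -/
lemma isOrthogonalityFunctional_of_apply_charlier {L : Polynomial R →ₗ[R] R}
    (hL : ∀ n, L (charlier a b c q n) = if n = 0 then 1 else 0) :
    IsOrthogonalityFunctional a b c q L := by
  have key : ∀ j i, j < i → L (charlier a b c q i * charlier a b c q j) = 0 := by
    intro j
    induction j using Nat.strong_induction_on with
    | _ j ih =>
      intro i hij
      match j with
      | 0 => rw [charlier, mul_one, hL, if_neg (by omega)]
      | j + 1 =>
        have h1 : charlier a b c q i * charlier a b c q (j + 1)
            = charlier a b c q (i + 1) * charlier a b c q j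
              + (c + b * qInt q i) • (charlier a b c q i * charlier a b c q j)
              + (a * qInt q i) • (charlier a b c q (i - 1) * charlier a b c q j)
              - (c + b * qInt q j) • (charlier a b c q i * charlier a b c q j)
              - (a * qInt q j) • (charlier a b c q i * charlier a b c q (j - 1)) := by
          simp only [Polynomial.smul_eq_C_mul]
          linear_combination charlier a b c q j * X_mul_charlier a b c q i
            - charlier a b c q i * X_mul_charlier a b c q j
        rw [h1]
        simp only [map_add, map_sub, map_smul]
        rw [ih j (by omega) (i + 1) (by omega), ih j (by omega) i (by omega),
          ih j (by omega) (i - 1) (by omega), ih (j - 1) (by omega) i (by omega)]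
        simp
  refine ⟨by simpa [charlier] using hL 0, fun i j hij => ?_⟩
  rcases lt_or_gt_of_ne hij with h | h
  · rw [mul_comm]; exact key _ _ h
  · exact key _ _ h

lemma linearMap_ext_charlier {M : Type*} [AddCommMonoid M] [Module R M]
    {L L' : Polynomial R →ₗ[R] M}
    (h : ∀ n, L (charlier a b c q n) = L' (charlier a b c q n)) : L = L' :=
  LinearMap.ext_on (span_charlier a b c q) (by rintro _ ⟨n, rfl⟩; exact h n)

lemma existsUnique_isOrthogonalityFunctional (a b c q : R) :
    ∃! L : Polynomial R →ₗ[R] R, IsOrthogonalityFunctional a b c q L :=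
  ⟨_, isOrthogonalityFunctional_of_apply_charlier (orthogonalityFunctional_charlier a b c q),
    fun L hL => linearMap_ext_charlier (a := a) (b := b) (c := c) (q := q) fun n => by
      rw [hL.apply_charlier, orthogonalityFunctional_charlier]⟩

variable (a b c q)

/-- Expand a product by inserting the `n` remaining elements of a box one by one, when `h` open
arcs start before the box and `k` open arcs start in it: each new element opens a block, or
continues or closes one of the `h` old arcs. -/
noncomputable def boxPoly : ℕ → ℕ → ℕ → Polynomial R
  | 0, h, k => charlier a b c q (h + k)
  | n + 1, h, k => boxPoly n h (k + 1)
      + Polynomial.C (b * q ^ k * qInt q h) * boxPoly n (h - 1) (k + 1)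
      + Polynomial.C (a * q ^ k * qInt q h) * boxPoly n (h - 1) k

lemma boxPoly_succ (n h k : ℕ) : boxPoly a b c q (n + 1) h k = boxPoly a b c q n h (k + 1)
      + Polynomial.C (b * q ^ k * qInt q h) * boxPoly a b c q n (h - 1) (k + 1)
      + Polynomial.C (a * q ^ k * qInt q h) * boxPoly a b c q n (h - 1) k := rfl

/-- In `n` this is the three-term recurrence of `C_n` plus an error term with factor `[k]_q`. Only
`k = 0` is wanted, where the error vanishes, but the recursion of `boxPoly` raises `k`, so the
induction needs the error term for all `k`. -/
lemma X_mul_boxPoly (n : ℕ) : ∀ h k,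
    Polynomial.X * boxPoly a b c q n h k = boxPoly a b c q (n + 1) h k
      + Polynomial.C (c + b * qInt q n) * boxPoly a b c q n h k
      + Polynomial.C (a * qInt q n) * boxPoly a b c q (n - 1) h k
      + Polynomial.C (q ^ n) * (Polynomial.C (b * qInt q k) * boxPoly a b c q n h k
        + Polynomial.C (a * qInt q k) * boxPoly a b c q n h (k - 1)) := by
  induction n with
  | zero =>
    intro h k
    have h1 : Polynomial.C (a * q ^ k * qInt q h) * charlier a b c q (h - 1 + k)
        = Polynomial.C (a * q ^ k * qInt q h) * charlier a b c q (h + k - 1) := by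
      cases h with
      | zero => simp
      | succ h => rw [show h + 1 + k - 1 = h + 1 - 1 + k by omega]
    have h2 : Polynomial.C (a * qInt q k) * charlier a b c q (h + (k - 1))
        = Polynomial.C (a * qInt q k) * charlier a b c q (h + k - 1) := by
      cases k with
      | zero => simp
      | succ k => rfl
    have h3 : Polynomial.C (b * q ^ k * qInt q h) * charlier a b c q (h - 1 + (k + 1))
        = Polynomial.C (b * q ^ k * qInt q h) * charlier a b c q (h + k) := by
      cases h with
      | zero => simp
      | succ h => rw [show h + 1 - 1 + (k + 1) = h + 1 + k by omega]
    simp only [boxPoly]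
    rw [h1, h2, h3, X_mul_charlier, qInt_add, add_assoc h k 1]
    simp only [qInt_zero, pow_zero, Polynomial.C_add, Polynomial.C_mul, Polynomial.C_1, map_zero,
      mul_zero, zero_mul]
    ring
  | succ n ih =>
    intro h k
    have e : Polynomial.X * boxPoly a b c q (n + 1) h k
        = Polynomial.X * boxPoly a b c q n h (k + 1)
        + Polynomial.C (b * q ^ k * qInt q h) * (Polynomial.X * boxPoly a b c q n (h - 1) (k + 1))
        + Polynomial.C (a * q ^ k * qInt q h) * (Polynomial.X * boxPoly a b c q n (h - 1) k) := by
      rw [boxPoly_succ]; ring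
    have hn : Polynomial.C (a * qInt q n) * boxPoly a b c q (n - 1 + 1) h k
        = Polynomial.C (a * qInt q n) * boxPoly a b c q n h k := by
      cases n with
      | zero => simp
      | succ n => rfl
    -- Unfolds the error term by one step; the truncated `k - 1` at `k = 0` is harmless because of
    -- the factor `[0]_q = 0`.
    have hk : Polynomial.C q * (Polynomial.C (qInt q k) * boxPoly a b c q (n + 1) h (k - 1))
        = Polynomial.C (qInt q k) * (Polynomial.C q * boxPoly a b c q n h k
          + Polynomial.C (b * q ^ k * qInt q h) * boxPoly a b c q n (h - 1) k
          + Polynomial.C (a * q ^ k * qInt q h) * boxPoly a b c q n (h - 1) (k - 1)) := by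
      cases k with
      | zero => simp
      | succ k =>
        rw [Nat.add_sub_cancel, boxPoly_succ]
        simp only [Polynomial.C_mul, pow_succ]
        ring
    -- Eliminates `q ^ k` in favour of `[k]_q`, so that the remaining identity is polynomial in
    -- independent quantities.
    have hq : Polynomial.C (q ^ k) = 1 - (1 - Polynomial.C q) * Polynomial.C (qInt q k) := by
      rw [← Polynomial.C_1, ← Polynomial.C_sub, ← Polynomial.C_mul, one_sub_mul_qInt]
      simp
    have hs := boxPoly_succ a b c q n h k
    rw [boxPoly_succ a b c q (n - 1)] at hn
    rw [e, ih h (k + 1), ih (h - 1) (k + 1), ih (h - 1) k, boxPoly_succ a b c q (n + 1) h k,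
      qInt_succ q n, pow_succ]
    simp only [Nat.add_sub_cancel, qInt_succ' q k, Polynomial.C_mul, Polynomial.C_add,
      Polynomial.C_1, hq] at hn hk hs ⊢
    linear_combination hn - Polynomial.C (q ^ n) * Polynomial.C a * hk
      - (Polynomial.C c + Polynomial.C b * (Polynomial.C (qInt q n) + Polynomial.C (q ^ n))
        + Polynomial.C (q ^ n) * Polynomial.C q * Polynomial.C b * Polynomial.C (qInt q k)) * hs

/-- The linearization of a product of two `q`-Charlier polynomials. -/
lemma boxPoly_eq_mul (n h : ℕ) :
    boxPoly a b c q n h 0 = charlier a b c q n * charlier a b c q h := by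
  induction n using Nat.strong_induction_on with
  | _ n ih =>
    match n with
    | 0 => simp [boxPoly, charlier]
    | n + 1 =>
      have h1 := X_mul_boxPoly a b c q n h 0
      have h2 := X_mul_charlier a b c q n
      rw [ih n (by omega), ih (n - 1) (by omega)] at h1
      simp only [qInt_zero, mul_zero, map_zero, zero_mul, add_zero] at h1
      linear_combination charlier a b c q h * h2 - h1

end Algebra

/-! ### Histories and their transfer recursion. -/

section Transfer

variable {R : Type*} [CommRing R] (a b q : R) {N : ℕ} (β : ℕ → ℕ)

/-- The open elements after step `t`: the predecessor chosen in the step is closed, and `t` itself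
is opened if the step says so. -/
def nextOpen (t : ℕ) (O : Finset (Fin N)) (s : Option (Fin N) × Bool) : Finset (Fin N) :=
  {i | (i ∈ O ∧ s.1 ≠ some i) ∨ ((i : ℕ) = t ∧ s.2 = true)}

/-- A step either opens a block, or chooses an open predecessor from an earlier box. -/
def Admissible (t : ℕ) (O : Finset (Fin N)) (s : Option (Fin N) × Bool) : Prop :=
  (s.1 = none → s.2 = true) ∧ ∀ i, s.1 = some i → i ∈ O ∧ (i : ℕ) < β t

/-- The weight of a step that chooses the predecessor `i`: the arc ending there crosses all
arcs that started after `i` and are still open. -/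
def chosenWeight (O : Finset (Fin N)) (s : Option (Fin N) × Bool) : R :=
  s.1.elim 1 fun i => (if s.2 = true then b else a) * q ^ (O.filter fun k => i < k).card

open Classical in
/-- The weight of a step, zero if the step is not admissible. -/
noncomputable def stepWeight (t : ℕ) (O : Finset (Fin N)) (s : Option (Fin N) × Bool) : R :=
  if Admissible β t O s then chosenWeight a b q O s else 0

/-- The weight of a sequence of steps that starts at time `t` with open elements `O` and has to
close all of them. -/
noncomputable def histWeight :
    (n : ℕ) → ℕ → Finset (Fin N) → (Fin n → Option (Fin N) × Bool) → R
  | 0, _, O, _ => if O = ∅ then 1 else 0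
  | n + 1, t, O, σ => stepWeight a b q β t O (σ 0)
      * histWeight n (t + 1) (nextOpen t O (σ 0)) (Fin.tail σ)

/-- The total weight of all sequences of `n` steps that start at time `t` with open
elements `O`. -/
noncomputable def transfer : ℕ → ℕ → Finset (Fin N) → R
  | 0, _, O => if O = ∅ then 1 else 0
  | n + 1, t, O => ∑ s, stepWeight a b q β t O s * transfer n (t + 1) (nextOpen t O s)

lemma sum_histWeight (n : ℕ) : ∀ (t : ℕ) (O : Finset (Fin N)),
    ∑ σ : Fin n → Option (Fin N) × Bool, histWeight a b q β n t O σ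
      = transfer a b q β n t O := by
  induction n with
  | zero => intro t O; simp [histWeight, transfer]
  | succ n ih =>
    intro t O
    rw [← (Fin.consEquiv fun _ => Option (Fin N) × Bool).sum_comp, Fintype.sum_prod_type, transfer]
    refine Finset.sum_congr rfl fun s _ => ?_
    rw [← ih, Finset.mul_sum]
    refine Finset.sum_congr rfl fun σ _ => ?_
    simp [histWeight, Fin.consEquiv]

/-- The elements of `O` that lie before the box starting at `s`. -/
def oldPart (s : ℕ) (O : Finset (Fin N)) : Finset (Fin N) := O.filter fun i => (i : ℕ) < s

/-- The elements of `O` that lie in the box starting at `s`, or later. -/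
def newPart (s : ℕ) (O : Finset (Fin N)) : Finset (Fin N) := O.filter fun i => s ≤ (i : ℕ)

lemma transfer_succ (n t : ℕ) (O : Finset (Fin N)) :
    transfer a b q β (n + 1) t O = transfer a b q β n (t + 1) (nextOpen t O (none, true))
      + ∑ i ∈ oldPart (β t) O, q ^ (O.filter fun k => i < k).card
        * (b * transfer a b q β n (t + 1) (nextOpen t O (some i, true))
          + a * transfer a b q β n (t + 1) (nextOpen t O (some i, false))) := by
  rw [transfer, Fintype.sum_prod_type, Fintype.sum_option]
  congr 1
  · simp [stepWeight, Admissible, chosenWeight]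
  · rw [← Finset.sum_subset (Finset.subset_univ (oldPart (β t) O))]
    · refine Finset.sum_congr rfl fun i hi => ?_
      have hi' : i ∈ O ∧ (i : ℕ) < β t := by simpa [oldPart] using hi
      simp [stepWeight, Admissible, chosenWeight, hi']
      ring
    · intro i _ hi
      have hi' : ¬ (i ∈ O ∧ (i : ℕ) < β t) := by simpa [oldPart] using hi
      simp [stepWeight, Admissible, hi']

/-- The exponents are the ranks counted from the top, hence `0, …, S.card - 1` once each: this is
where `[h]_q` comes from. -/
lemma sum_pow_card_gt {α : Type*} [LinearOrder α] (S : Finset α) :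
    ∑ i ∈ S, q ^ (S.filter fun k => i < k).card = qInt q S.card := by
  induction S using Finset.induction_on_min with
  | empty => simp
  | insert x S hx ih =>
    have hxS : x ∉ S := fun h => lt_irrefl _ (hx x h)
    rw [Finset.sum_insert hxS, Finset.card_insert_of_notMem hxS, qInt_succ, ← ih, add_comm]
    congr 1
    · refine Finset.sum_congr rfl fun i hi => ?_
      rw [Finset.filter_insert, if_neg (not_lt.2 (hx i hi).le)]
    · rw [Finset.filter_insert, if_neg (lt_irrefl x), Finset.filter_true_of_mem hx]

lemma card_oldPart_add_card_newPart (s : ℕ) (O : Finset (Fin N)) :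
    (oldPart s O).card + (newPart s O).card = O.card := by
  rw [oldPart, newPart, ← Finset.card_filter_add_card_filter_not (s := O) (fun i => (i : ℕ) < s)]
  simp

/-- Every arc opened inside the box starts to the right of every old one, so an arc that ends in the
box crosses all of them. This is the factor `q ^ k` in `boxPoly`. -/
lemma card_filter_gt_of_mem_oldPart {s : ℕ} {O : Finset (Fin N)} {i : Fin N}
    (hi : i ∈ oldPart s O) :
    (O.filter fun k => i < k).card
      = (newPart s O).card + ((oldPart s O).filter fun k => i < k).card := by
  rw [oldPart, Finset.mem_filter] at hi
  rw [← Finset.card_filter_add_card_filter_not (s := O.filter fun k => i < k)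
    (fun k => s ≤ (k : ℕ)), oldPart, newPart, Finset.filter_filter, Finset.filter_filter,
    Finset.filter_filter]
  congr 2 <;> ext k <;> simp only [Finset.mem_filter, Fin.lt_def] <;> grind

lemma oldPart_nextOpen {s t : ℕ} {O : Finset (Fin N)} (hs : s ≤ t) (p : Option (Fin N))
    (f : Bool) : oldPart s (nextOpen t O (p, f)) = (oldPart s O).filter fun i => p ≠ some i := by
  ext i
  simp only [oldPart, nextOpen, Finset.mem_filter, Finset.mem_univ, true_and]
  constructor
  · rintro ⟨h | h, h'⟩
    · exact ⟨⟨h.1, h'⟩, h.2⟩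
    · omega
  · rintro ⟨⟨h, h'⟩, h''⟩
    exact ⟨Or.inl ⟨h, h''⟩, h'⟩

lemma card_newPart_nextOpen {s t : ℕ} {O : Finset (Fin N)} (hs : s ≤ t) (ht : t < N)
    (hO : ∀ i ∈ O, (i : ℕ) < t) (p : Option (Fin N)) (hp : ∀ i, p = some i → (i : ℕ) < s)
    (f : Bool) :
    (newPart s (nextOpen t O (p, f))).card = (newPart s O).card + if f = true then 1 else 0 := by
  have h : newPart s (nextOpen t O (p, f))
      = if f = true then insert ⟨t, ht⟩ (newPart s O) else newPart s O := by
    ext i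
    have hp' : s ≤ (i : ℕ) → p ≠ some i := fun h h' => absurd (hp i h') (by omega)
    cases f <;> simp [newPart, nextOpen, Fin.ext_iff] <;> grind
  rw [h]
  split_ifs
  · rw [Finset.card_insert_of_notMem]
    intro hmem
    exact lt_irrefl t (hO _ (Finset.mem_filter.1 hmem).1)
  · simp

lemma lt_of_mem_nextOpen {t : ℕ} {O : Finset (Fin N)} (hO : ∀ i ∈ O, (i : ℕ) < t)
    {s : Option (Fin N) × Bool} {i : Fin N} (hi : i ∈ nextOpen t O s) : (i : ℕ) < t + 1 := by
  simp only [nextOpen, Finset.mem_filter, Finset.mem_univ, true_and] at hi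
  rcases hi with h | h
  · have := hO i h.1; omega
  · omega

variable (c : R)

/-- Passing through a box: if the weight of the steps after a box is a functional of the number
of open elements, then so is the weight of the steps from within the box. -/
lemma transfer_box (L : Polynomial R →ₗ[R] R) (Q : Polynomial R) (s l n : ℕ)
    (hN : s + l ≤ N) (hβ : ∀ t, s ≤ t → t < s + l → β t = s)
    (h : ∀ O : Finset (Fin N), (∀ i ∈ O, (i : ℕ) < s + l) →
      transfer a b q β n (s + l) O = L (charlier a b c q O.card * Q)) (r : ℕ) :
    ∀ t, s ≤ t → t + r = s + l → ∀ O : Finset (Fin N), (∀ i ∈ O, (i : ℕ) < t) →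
      transfer a b q β (n + r) t O
        = L (boxPoly a b c q r (oldPart s O).card (newPart s O).card * Q) := by
  induction r with
  | zero =>
    intro t _ ht O hO
    obtain rfl : t = s + l := by omega
    rw [boxPoly, card_oldPart_add_card_newPart]
    exact h O hO
  | succ r ih =>
    intro t hst ht O hO
    have hst' : s ≤ t + 1 := by omega
    have ih' := fun u => ih (t + 1) hst' (by omega) (nextOpen t O u)
      (fun i hi => lt_of_mem_nextOpen hO hi)
    have hmem : ∀ i ∈ oldPart s O, i ∈ O ∧ (i : ℕ) < s := fun i hi => by
      simpa [oldPart] using hi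
    have hcard : ∀ i ∈ oldPart s O, ∀ f,
        (oldPart s (nextOpen t O (some i, f))).card = (oldPart s O).card - 1 := by
      intro i hi f
      rw [oldPart_nextOpen hst, ← Finset.card_erase_of_mem hi]
      congr 1
      ext j
      simp [and_comm, eq_comm]
    have hnew : ∀ i ∈ oldPart s O, ∀ f, (newPart s (nextOpen t O (some i, f))).card
        = (newPart s O).card + if f = true then 1 else 0 := fun i hi f =>
      card_newPart_nextOpen hst (by omega) hO _ (fun j hj => by
        obtain rfl : i = j := by simpa using hj
        exact (hmem i hi).2) f
    rw [← add_assoc n r 1, transfer_succ, hβ t hst (by omega), ih', oldPart_nextOpen hst,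
      card_newPart_nextOpen hst (by omega) hO none (by simp), boxPoly_succ]
    -- After the choice of `i` the induction hypothesis sees only the two cardinalities, so `i`
    -- survives only in its rank among the old arcs.
    have hsum : ∀ i ∈ oldPart s O, q ^ (O.filter fun k => i < k).card
        * (b * transfer a b q β (n + r) (t + 1) (nextOpen t O (some i, true))
          + a * transfer a b q β (n + r) (t + 1) (nextOpen t O (some i, false)))
        = q ^ ((oldPart s O).filter fun k => i < k).card * (q ^ (newPart s O).card
          * (b * L (boxPoly a b c q r ((oldPart s O).card - 1) ((newPart s O).card + 1) * Q)
          + a * L (boxPoly a b c q r ((oldPart s O).card - 1) (newPart s O).card * Q))) := by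
      intro i hi
      rw [ih', ih', hcard i hi, hcard i hi, hnew i hi, hnew i hi,
        card_filter_gt_of_mem_oldPart hi, pow_add]
      simp only [if_true, Bool.false_eq_true, if_false, add_zero]
      ring
    rw [Finset.sum_congr rfl hsum, ← Finset.sum_mul, sum_pow_card_gt]
    simp only [add_mul, map_add, mul_assoc, ← Polynomial.smul_eq_C_mul, smul_mul_assoc, map_smul,
      smul_eq_mul, if_true]
    simp
    ring

end Transfer

/-! ### Box boundaries, and the transfer across all boxes. -/

section Boxes

variable {m : ℕ} (n : Fin m → ℕ)

/-- The number of elements in the first `k` boxes. -/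
def boxStart (k : ℕ) : ℕ := ∑ i ∈ Finset.univ.filter (fun i : Fin m => (i : ℕ) < k), n i

/-- The first element of the box that contains `t`. -/
def currentStart (t : ℕ) : ℕ :=
  ((Finset.range (m + 1)).filter fun k => boxStart n k ≤ t).sup (boxStart n)

@[simp] lemma boxStart_zero : boxStart n 0 = 0 := by simp [boxStart]

lemma boxStart_length : boxStart n m = ∑ i, n i := by simp [boxStart]

lemma boxStart_succ {k : ℕ} (hk : k < m) : boxStart n (k + 1) = boxStart n k + n ⟨k, hk⟩ := by
  have h : (Finset.univ.filter fun i : Fin m => (i : ℕ) < k + 1)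
      = insert ⟨k, hk⟩ (Finset.univ.filter fun i : Fin m => (i : ℕ) < k) := by
    ext i; simp [Fin.ext_iff]; omega
  rw [boxStart, h, Finset.sum_insert (by simp), add_comm]
  rfl

lemma boxStart_mono : Monotone (boxStart n) := fun k l hkl =>
  Finset.sum_le_sum_of_subset fun i hi => by
    simp only [Finset.mem_filter, Finset.mem_univ, true_and] at hi ⊢; omega

lemma currentStart_eq {k t : ℕ} (hk : k < m) (h1 : boxStart n k ≤ t)
    (h2 : t < boxStart n (k + 1)) : currentStart n t = boxStart n k := by
  apply le_antisymm
  · refine Finset.sup_le fun l hl => ?_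
    rw [Finset.mem_filter] at hl
    by_contra! hlt
    have hkl : k + 1 ≤ l := by
      by_contra! h
      exact absurd (boxStart_mono n (show l ≤ k by omega)) (by omega)
    have := boxStart_mono n hkl
    omega
  · exact Finset.le_sup (f := boxStart n) (by simp; omega)

lemma exists_box_of_lt {t : ℕ} : ∀ k, t < boxStart n k →
    ∃ j < k, boxStart n j ≤ t ∧ t < boxStart n (j + 1) := by
  intro k
  induction k with
  | zero => simp
  | succ k ih =>
    intro h
    by_cases h' : t < boxStart n k
    · obtain ⟨j, hj, hj'⟩ := ih h'
      exact ⟨j, by omega, hj'⟩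
    · exact ⟨k, by omega, by omega, h⟩

lemma mem_box {j : Fin m} {x : Fin (∑ i, n i)} :
    x ∈ box n j ↔ boxStart n j ≤ x ∧ (x : ℕ) < boxStart n (j + 1) := by
  have h1 : Finset.Iio j = Finset.univ.filter fun i : Fin m => (i : ℕ) < j := by
    ext i; simp
  have h2 : Finset.Iic j = Finset.univ.filter fun i : Fin m => (i : ℕ) < j + 1 := by
    ext i; simp
  simp [box, boxStart, h1, h2]

lemma exists_mem_box_iff {x y : Fin (∑ i, n i)} (hxy : x < y) :
    (∃ j, x ∈ box n j ∧ y ∈ box n j) ↔ currentStart n y ≤ x := by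
  simp only [mem_box]
  constructor
  · rintro ⟨j, hx, hy⟩
    rw [currentStart_eq n j.2 hy.1 hy.2]
    exact hx.1
  · intro h
    obtain ⟨j, hj, hy⟩ := exists_box_of_lt n m (t := y) (by rw [boxStart_length]; exact y.2)
    rw [currentStart_eq n hj hy.1 hy.2] at h
    exact ⟨⟨j, hj⟩, ⟨h, lt_trans hxy hy.2⟩, hy⟩

variable {R : Type*} [CommRing R] {a b c q : R}

/-- Backward induction over the boxes. With none left, only `O = ∅` counts, and this is the value of
`L` at `charlier O.card`. At a box start all open elements are old, so `boxPoly` occurs with `k = 0`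
and is a product. -/
lemma transfer_boxStart {L : Polynomial R →ₗ[R] R} (hL : IsOrthogonalityFunctional a b c q L)
    (d : ℕ) : ∀ k, k + d = m → ∀ O : Finset (Fin (∑ i, n i)),
      (∀ i ∈ O, (i : ℕ) < boxStart n k) →
      transfer a b q (currentStart n) ((∑ i, n i) - boxStart n k) (boxStart n k) O
        = L (charlier a b c q O.card
          * ∏ i ∈ Finset.univ.filter (fun i : Fin m => k ≤ (i : ℕ)), charlier a b c q (n i)) := by
  induction d with
  | zero =>
    intro k hk O _
    obtain rfl : k = m := hk
    have h : (Finset.univ.filter fun i : Fin k => k ≤ (i : ℕ)) = ∅ := by ext i; simp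
    rw [boxStart_length, Nat.sub_self, transfer, h, Finset.prod_empty, mul_one,
      hL.apply_charlier]
    simp
  | succ d ih =>
    intro k hk O hO
    have hkm : k < m := by omega
    have hs := boxStart_succ n hkm
    have hle : boxStart n (k + 1) ≤ ∑ i, n i := by
      rw [← boxStart_length]; exact boxStart_mono n (by omega)
    have hsplit : (Finset.univ.filter fun i : Fin m => k ≤ (i : ℕ))
        = insert ⟨k, hkm⟩ (Finset.univ.filter fun i : Fin m => k + 1 ≤ (i : ℕ)) := by
      ext i; simp [Fin.ext_iff]; omega
    have key := transfer_box a b q (currentStart n) c L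
      (∏ i ∈ Finset.univ.filter (fun i : Fin m => k + 1 ≤ (i : ℕ)), charlier a b c q (n i))
      (boxStart n k) (n ⟨k, hkm⟩)
      ((∑ i, n i) - boxStart n (k + 1)) (by omega)
      (fun t h1 h2 => currentStart_eq n hkm h1 (by omega))
      (fun O hO => by rw [← hs] at hO ⊢; exact ih (k + 1) (by omega) O hO) (n ⟨k, hkm⟩)
      (boxStart n k) le_rfl rfl O hO
    have hold : oldPart (boxStart n k) O = O := Finset.filter_true_of_mem hO
    have hnew : newPart (boxStart n k) O = ∅ := Finset.filter_false_of_mem fun i hi => by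
      have := hO i hi; omega
    rw [hold, hnew, Finset.card_empty, boxPoly_eq_mul] at key
    rw [hsplit, Finset.prod_insert (by simp), ← mul_assoc, mul_comm (charlier a b c q O.card),
      ← key]
    congr 1
    omega

lemma transfer_eq {L : Polynomial R →ₗ[R] R} (hL : IsOrthogonalityFunctional a b c q L) :
    transfer a b q (currentStart n) (∑ i, n i) 0 (∅ : Finset (Fin (∑ i, n i)))
      = L (∏ i, charlier a b c q (n i)) := by
  have := transfer_boxStart n hL m 0 (by simp) ∅ (by simp)
  simpa [charlier] using this

end Boxes

/-! ### Open elements of a complete history, and its weight as a product. -/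

section Histories

variable {N : ℕ}

/-- The elements that are open just before time `t`. -/
def openAt (σ : Fin N → Option (Fin N) × Bool) (t : ℕ) : Finset (Fin N) :=
  {i | (i : ℕ) < t ∧ (σ i).2 = true ∧ ∀ j : Fin N, i < j → (j : ℕ) < t → (σ j).1 ≠ some i}

/-- All steps are admissible and no element remains open. -/
def Valid (β : ℕ → ℕ) (σ : Fin N → Option (Fin N) × Bool) : Prop :=
  (∀ t : Fin N, Admissible β t (openAt σ t) (σ t)) ∧ openAt σ N = ∅

lemma nextOpen_openAt (σ : Fin N → Option (Fin N) × Bool) (t : Fin N) :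
    nextOpen t (openAt σ t) (σ t) = openAt σ (t + 1) := by
  ext i
  simp only [nextOpen, openAt, Finset.mem_filter, Finset.mem_univ, true_and]
  constructor
  · rintro (⟨⟨h1, h2, h3⟩, h4⟩ | ⟨h1, h2⟩)
    · refine ⟨by omega, h2, fun j hij hj => ?_⟩
      rcases Nat.lt_succ_iff_lt_or_eq.1 hj with h | h
      · exact h3 j hij h
      · obtain rfl : j = t := Fin.ext h
        exact h4
    · obtain rfl : i = t := Fin.ext h1
      exact ⟨by omega, h2, fun j hij hj => absurd hij (by rw [Fin.lt_def]; omega)⟩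
  · rintro ⟨h1, h2, h3⟩
    rcases Nat.lt_succ_iff_lt_or_eq.1 h1 with h | h
    · exact Or.inl ⟨⟨h, h2, fun j hij hj => h3 j hij (by omega)⟩, h3 t h (by omega)⟩
    · obtain rfl : i = t := Fin.ext h
      exact Or.inr ⟨rfl, h2⟩

variable {R : Type*} [CommRing R] (a b q : R) (β : ℕ → ℕ)

/-- The open set reached by the recursion is determined by the history as `openAt`, so the recursive
weight unfolds into a product over elements. -/
lemma histWeight_openAt (σ : Fin N → Option (Fin N) × Bool) (n : ℕ) :
    ∀ t, t + n = N → ∀ τ : Fin n → Option (Fin N) × Bool,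
      (∀ (i : Fin n) (h : t + i < N), τ i = σ ⟨t + i, h⟩) →
      histWeight a b q β n t (openAt σ t) τ
        = (∏ j ∈ Finset.univ.filter (fun j : Fin N => t ≤ (j : ℕ)),
            stepWeight a b q β j (openAt σ j) (σ j))
          * if openAt σ N = ∅ then 1 else 0 := by
  induction n with
  | zero =>
    intro t ht τ _
    obtain rfl : t = N := ht
    have h : (Finset.univ.filter fun i : Fin t => t ≤ (i : ℕ)) = ∅ := by ext i; simp
    simp [histWeight, h]
  | succ n ih =>
    intro t ht τ hτ
    have htN : t < N := by omega
    have hsplit : (Finset.univ.filter fun i : Fin N => t ≤ (i : ℕ))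
        = insert ⟨t, htN⟩ (Finset.univ.filter fun i : Fin N => t + 1 ≤ (i : ℕ)) := by
      ext i; simp [Fin.ext_iff]; omega
    have h0 : τ 0 = σ ⟨t, htN⟩ := by simpa using hτ 0 (by simpa using htN)
    rw [histWeight, hsplit, Finset.prod_insert (by simp), h0, mul_assoc]
    congr 1
    rw [← ih (t + 1) (by omega) (Fin.tail τ), ← nextOpen_openAt σ ⟨t, htN⟩]
    intro i h
    rw [Fin.tail, hτ i.succ (by simp; omega)]
    congr 2
    simp; omega

-- An invalid history contributes zero to the full sum: either some step is inadmissible or an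
-- element stays open at the end.
open Classical in
lemma sum_valid_eq_transfer :
    ∑ σ : Fin N → Option (Fin N) × Bool with Valid β σ,
      ∏ j : Fin N, chosenWeight a b q (openAt σ j) (σ j)
      = transfer a b q β N 0 (∅ : Finset (Fin N)) := by
  rw [← sum_histWeight, Finset.sum_filter]
  refine Finset.sum_congr rfl fun σ _ => ?_
  have h0 : (∅ : Finset (Fin N)) = openAt σ 0 := by ext i; simp [openAt]
  rw [h0, histWeight_openAt a b q β σ N 0 (by simp) σ (fun i h => by congr 1; ext; simp)]
  simp only [zero_le, Finset.filter_true]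
  split_ifs with hv hN hN
  · rw [mul_one]
    exact Finset.prod_congr rfl fun j _ => by rw [stepWeight, if_pos (hv.1 j)]
  · exact absurd hv.2 hN
  · rw [mul_one]
    have : ∃ t : Fin N, ¬ Admissible β t (openAt σ t) (σ t) := by
      by_contra! h
      exact hv ⟨h, hN⟩
    obtain ⟨t, ht⟩ := this
    rw [Finset.prod_eq_zero (Finset.mem_univ t)]
    rw [stepWeight, if_neg ht]
  · rw [mul_zero]

end Histories

/-! ### A partition is determined by its arcs. -/

section Arcs

variable {N : ℕ} (π : SetPartition N)

lemma isArc_iff {i j : Fin N} : IsArc π i j ↔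
    i < j ∧ π.part i = π.part j ∧ ∀ p, π.part p = π.part j → ¬ (i < p ∧ p < j) := by
  constructor
  · rintro ⟨hij, B, hB, hi, hj, h⟩
    rw [π.part_eq_of_mem hB hi, π.part_eq_of_mem hB hj]
    exact ⟨hij, rfl, fun p hp => h p ((π.part_eq_iff_mem hB).1 hp)⟩
  · rintro ⟨hij, h1, h2⟩
    refine ⟨hij, π.part j, by simp, h1 ▸ π.mem_part (Finset.mem_univ i),
      π.mem_part (Finset.mem_univ j), fun p hp => h2 p ?_⟩
    exact (π.mem_part_iff_part_eq_part (Finset.mem_univ _) (Finset.mem_univ _)).1 hp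

variable {π}

lemma IsArc.left_unique {i i' j : Fin N} (h : IsArc π i j) (h' : IsArc π i' j) : i = i' := by
  rw [isArc_iff] at h h'
  rcases lt_trichotomy i i' with hlt | heq | hlt
  · exact absurd ⟨hlt, h'.1⟩ (h.2.2 i' h'.2.1)
  · exact heq
  · exact absurd ⟨hlt, h.1⟩ (h'.2.2 i h.2.1)

lemma IsArc.right_unique {i j j' : Fin N} (h : IsArc π i j) (h' : IsArc π i j') : j = j' := by
  rw [isArc_iff] at h h'
  have hjj : π.part j = π.part j' := h.2.1.symm.trans h'.2.1
  rcases lt_trichotomy j j' with hlt | heq | hlt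
  · exact absurd ⟨h.1, hlt⟩ (h'.2.2 j hjj)
  · exact heq
  · exact absurd ⟨h'.1, hlt⟩ (h.2.2 j' hjj.symm)

lemma exists_isArc_left {i j : Fin N} (hij : i < j) (h : π.part i = π.part j) :
    ∃ i', IsArc π i' j := by
  obtain ⟨i', hi', hmax⟩ := Finset.exists_max_image
    (Finset.univ.filter fun k => k < j ∧ π.part k = π.part j) id ⟨i, by simp [hij, h]⟩
  simp only [Finset.mem_filter, Finset.mem_univ, true_and, id] at hi' hmax
  exact ⟨i', (isArc_iff π).2 ⟨hi'.1, hi'.2, fun p hp hlt =>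
    absurd (hmax p ⟨hlt.2, hp⟩) (not_le.2 hlt.1)⟩⟩

lemma exists_isArc_right {i j : Fin N} (hij : i < j) (h : π.part i = π.part j) :
    ∃ j', IsArc π i j' := by
  obtain ⟨j', hj', hmin⟩ := Finset.exists_min_image
    (Finset.univ.filter fun k => i < k ∧ π.part i = π.part k) id ⟨j, by simp [hij, h]⟩
  simp only [Finset.mem_filter, Finset.mem_univ, true_and, id] at hj' hmin
  exact ⟨j', (isArc_iff π).2 ⟨hj'.1, hj'.2, fun p hp hlt =>
    absurd (hmin p ⟨hlt.1, hj'.2.trans hp.symm⟩) (not_le.2 hlt.2)⟩⟩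

variable (π)

open Classical in
/-- The predecessor of an element in its block. -/
noncomputable def pred (j : Fin N) : Option (Fin N) :=
  if h : ∃ i, IsArc π i j then some h.choose else none

lemma pred_eq_some {i j : Fin N} : pred π j = some i ↔ IsArc π i j := by
  rw [pred]
  split_ifs with h
  · rw [Option.some_inj]
    exact ⟨fun e => e ▸ h.choose_spec, fun h' => h.choose_spec.left_unique h'⟩
  · simpa using fun h' => h ⟨i, h'⟩

lemma pred_eq_none {j : Fin N} : pred π j = none ↔ ∀ i, ¬ IsArc π i j := by
  simp only [← pred_eq_some, Option.eq_none_iff_forall_ne_some]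

open Classical in
/-- The history of a partition: the predecessor of each element, and whether it has a
successor. -/
noncomputable def history (j : Fin N) : Option (Fin N) × Bool :=
  (pred π j, decide (∃ l, IsArc π j l))

lemma history_fst (j : Fin N) : (history π j).1 = pred π j := rfl

lemma history_snd {j : Fin N} : (history π j).2 = true ↔ ∃ l, IsArc π j l := by simp [history]

lemma mem_openAt_history {i : Fin N} {t : ℕ} :
    i ∈ openAt (history π) t ↔ (i : ℕ) < t ∧ ∃ l : Fin N, IsArc π i l ∧ t ≤ (l : ℕ) := by
  simp only [openAt, Finset.mem_filter, Finset.mem_univ, true_and, history_snd, history_fst,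
    ne_eq, pred_eq_some]
  refine and_congr_right fun _ => ⟨?_, ?_⟩
  · rintro ⟨⟨l, hl⟩, h⟩
    refine ⟨l, hl, ?_⟩
    by_contra! hlt
    exact h l hl.1 hlt hl
  · rintro ⟨l, hl, hlt⟩
    refine ⟨⟨l, hl⟩, fun j _ hj harc => ?_⟩
    rw [harc.right_unique hl] at hj
    omega

/-- The successive predecessors of an element lead to the least element of its block. -/
def root (p : Fin N → Option (Fin N)) (j : Fin N) : Fin N :=
  match p j with
  | none => j
  -- The guard makes the recursion terminate for arbitrary `p`; it holds for every predecessor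
  -- function that occurs later.
  | some i => if i < j then root p i else j
termination_by j

lemma root_of_none {p : Fin N → Option (Fin N)} {j : Fin N} (h : p j = none) :
    root p j = j := by
  rw [root, h]

lemma root_of_some {p : Fin N → Option (Fin N)} {i j : Fin N} (h : p j = some i) (hij : i < j) :
    root p j = root p i := by
  rw [root, h]
  exact if_pos hij

lemma root_pred_spec (j : Fin N) :
    π.part (root (pred π) j) = π.part j ∧ pred π (root (pred π) j) = none := by
  induction j using WellFoundedLT.induction with
  | _ j ih =>
    cases h : pred π j with
    | none => rw [root_of_none h]; exact ⟨rfl, h⟩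
    | some i =>
      have harc := (pred_eq_some π).1 h
      rw [root_of_some h harc.1]
      exact ⟨(ih i harc.1).1.trans ((isArc_iff π).1 harc).2.1, (ih i harc.1).2⟩

/-- Within a block only the least element has no predecessor, so elements of one block share their
root. -/
lemma root_pred_eq_iff {i j : Fin N} :
    root (pred π) i = root (pred π) j ↔ π.part i = π.part j := by
  obtain ⟨hi, hi'⟩ := root_pred_spec π i
  obtain ⟨hj, hj'⟩ := root_pred_spec π j
  constructor
  · intro h; rw [← hi, h, hj]
  · intro h
    have he : π.part (root (pred π) i) = π.part (root (pred π) j) := by rw [hi, hj, h]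
    rw [pred_eq_none] at hi' hj'
    rcases lt_trichotomy (root (pred π) i) (root (pred π) j) with hlt | heq | hlt
    · obtain ⟨k, hk⟩ := exists_isArc_left hlt he
      exact absurd hk (hj' k)
    · exact heq
    · obtain ⟨k, hk⟩ := exists_isArc_left hlt he.symm
      exact absurd hk (hi' k)

lemma setPartition_ext {π π' : SetPartition N}
    (h : ∀ i j, π.part i = π.part j ↔ π'.part i = π'.part j) : π = π' := by
  have hpart : ∀ i, π.part i = π'.part i := by
    intro i
    ext j
    rw [π.mem_part_iff_part_eq_part (Finset.mem_univ _) (Finset.mem_univ _),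
      π'.mem_part_iff_part_eq_part (Finset.mem_univ _) (Finset.mem_univ _), h]
  have hsub : ∀ π π' : SetPartition N, (∀ i, π.part i = π'.part i) → π.parts ⊆ π'.parts := by
    intro π π' h B hB
    obtain ⟨i, hi⟩ := π.nonempty_of_mem_parts hB
    rw [← π.part_eq_of_mem hB hi, h i]
    simp
  exact Finpartition.ext ((hsub _ _ hpart).antisymm (hsub _ _ fun i => (hpart i).symm))

lemma history_injective : Function.Injective (history : SetPartition N → _) := by
  intro π π' h
  have hp : pred π = pred π' := funext fun j => congrArg Prod.fst (congrFun h j)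
  exact setPartition_ext fun i j => by
    rw [← root_pred_eq_iff, ← root_pred_eq_iff, hp]

end Arcs

/-! ### From a predecessor function back to a partition. -/

section OfHistory

variable {N : ℕ} {p : Fin N → Option (Fin N)}

open Classical in
/-- The partition whose arcs are given by the predecessor function `p`. -/
noncomputable def ofPred (p : Fin N → Option (Fin N)) : SetPartition N :=
  Finpartition.ofSetoid (Setoid.ker (root p))

open Classical in
lemma part_ofPred_eq_iff {i j : Fin N} :
    (ofPred p).part i = (ofPred p).part j ↔ root p i = root p j := by
  rw [← (ofPred p).mem_part_iff_part_eq_part (Finset.mem_univ _) (Finset.mem_univ _)]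
  exact Finpartition.mem_part_ofSetoid_iff_rel.trans (Setoid.ker_def.trans eq_comm)

variable (hlt : ∀ i j, p j = some i → i < j)
  (hinj : ∀ i j j', p j = some i → p j' = some i → j = j')
include hlt

lemma root_le (j : Fin N) : root p j ≤ j := by
  induction j using WellFoundedLT.induction with
  | _ j ih =>
    cases h : p j with
    | none => rw [root_of_none h]
    | some i =>
      rw [root_of_some h (hlt i j h)]
      exact (ih i (hlt i j h)).trans (hlt i j h).le

include hinj

/-- Elements with the same root lie on one chain, since injectivity of `p` forbids branching. Hence
going down from `j` cannot bypass `i`, and the last step before `i` is the required `k`. -/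
lemma exists_succ_of_root_eq (j : Fin N) : ∀ i < j, root p i = root p j →
    ∃ k, i < k ∧ k ≤ j ∧ p k = some i := by
  induction j using WellFoundedLT.induction with
  | _ j ih =>
    intro i hij h
    cases hj : p j with
    | none =>
      rw [root_of_none hj] at h
      have := root_le hlt i
      rw [h] at this
      exact absurd hij (not_lt.2 this)
    | some l =>
      have hl := hlt l j hj
      rw [root_of_some hj hl] at h
      rcases lt_trichotomy l i with hli | rfl | hli
      · obtain ⟨k, h1, h2, h3⟩ := ih i hij l hli h.symm
        obtain rfl := hinj _ _ _ h3 hj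
        exact absurd hij (not_lt.2 h2)
      · exact ⟨j, hl, le_rfl, hj⟩
      · obtain ⟨k, h1, h2, h3⟩ := ih l hl i hli h
        exact ⟨k, h1, h2.trans hl.le, h3⟩

lemma isArc_ofPred_iff {i j : Fin N} : IsArc (ofPred p) i j ↔ p j = some i := by
  rw [isArc_iff]
  simp only [part_ofPred_eq_iff]
  constructor
  · rintro ⟨hij, h, hbetween⟩
    obtain ⟨k, h1, h2, h3⟩ := exists_succ_of_root_eq hlt hinj j i hij h
    rcases h2.lt_or_eq with h2 | rfl
    · refine absurd ⟨h1, h2⟩ (hbetween k ?_)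
      rw [root_of_some h3 h1, h]
    · exact h3
  · intro h
    have hij := hlt i j h
    refine ⟨hij, (root_of_some h hij).symm, fun k hk hk' => ?_⟩
    rw [root_of_some h hij] at hk
    obtain ⟨l, h1, h2, h3⟩ := exists_succ_of_root_eq hlt hinj k i hk'.1 hk.symm
    obtain rfl := hinj _ _ _ h h3
    exact absurd hk'.2 (not_lt.2 h2)

end OfHistory

/-! ### Inhomogeneous partitions correspond to valid histories. -/

section Bijection

variable {m : ℕ} {n : Fin m → ℕ}

lemma IsArc.not_same_box {π : SetPartition (∑ i, n i)} (h : IsInhomogeneous n π)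
    {i j : Fin (∑ i, n i)} (hij : IsArc π i j) : (i : ℕ) < currentStart n j := by
  by_contra! hle
  obtain ⟨k, hk⟩ := (exists_mem_box_iff n hij.1).2 hle
  obtain ⟨hlt, B, hB, hi, hj, -⟩ := hij
  exact (h B hB).2 i hi j hj hlt.ne k hk

lemma exists_isArc_of_isInhomogeneous {π : SetPartition (∑ i, n i)} (h : IsInhomogeneous n π)
    (j : Fin (∑ i, n i)) : (∃ i, IsArc π i j) ∨ ∃ l, IsArc π j l := by
  have hB : π.part j ∈ π.parts := by simp
  obtain ⟨k, hk, hkj⟩ := Finset.exists_mem_ne ((h _ hB).1) j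
  have he := (π.mem_part_iff_part_eq_part (Finset.mem_univ _) (Finset.mem_univ _)).1 hk
  rcases lt_or_gt_of_ne hkj with hlt | hlt
  · exact Or.inl (exists_isArc_left hlt he)
  · exact Or.inr (exists_isArc_right hlt he.symm)

lemma valid_history {π : SetPartition (∑ i, n i)} (h : IsInhomogeneous n π) :
    Valid (currentStart n) (history π) := by
  refine ⟨fun t => ⟨fun ht => ?_, fun i hi => ?_⟩, ?_⟩
  · rw [history_fst, pred_eq_none] at ht
    rw [history_snd]
    exact (exists_isArc_of_isInhomogeneous h t).resolve_left fun ⟨i, hi⟩ => ht i hi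
  · rw [history_fst, pred_eq_some] at hi
    exact ⟨(mem_openAt_history π).2 ⟨hi.1, t, hi, le_rfl⟩, hi.not_same_box h⟩
  · ext i
    rw [mem_openAt_history]
    simp only [Finset.notMem_empty, iff_false]
    rintro ⟨-, l, -, hl⟩
    exact absurd l.2 (by omega)

/-- A chosen predecessor is open, hence earlier and not chosen before: the predecessor function is
decreasing and injective, and is therefore the arc set of a partition. -/
lemma exists_history_eq {σ : Fin (∑ i, n i) → Option (Fin (∑ i, n i)) × Bool}
    (hσ : Valid (currentStart n) σ) : ∃ π, IsInhomogeneous n π ∧ history π = σ := by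
  have hopen : ∀ i j, (σ j).1 = some i → i < j ∧ (σ i).2 = true ∧
      ∀ k : Fin (∑ i, n i), i < k → k < j → (σ k).1 ≠ some i := by
    intro i j h
    have := ((hσ.1 j).2 i h).1
    simpa [openAt] using this
  have hlt : ∀ i j, (σ j).1 = some i → i < j := fun i j h => (hopen i j h).1
  have hinj : ∀ i j j', (σ j).1 = some i → (σ j').1 = some i → j = j' := by
    intro i j j' h h'
    rcases lt_trichotomy j j' with hjj | hjj | hjj
    · exact absurd h ((hopen i j' h').2.2 j (hlt i j h) hjj)
    · exact hjj
    · exact absurd h' ((hopen i j h).2.2 j' (hlt i j' h') hjj)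
  have harc : ∀ i j, IsArc (ofPred fun j => (σ j).1) i j ↔ (σ j).1 = some i :=
    fun i j => isArc_ofPred_iff hlt hinj
  -- An opened element without successor would still be open at the end, contradicting `openAt σ N =
  -- ∅`.
  have hsucc : ∀ j, (∃ l, (σ l).1 = some j) ↔ (σ j).2 = true := by
    intro j
    constructor
    · rintro ⟨l, hl⟩
      exact (hopen j l hl).2.1
    · intro hj
      by_contra! hnone
      have : j ∈ openAt σ (∑ i, n i) := by simp [openAt, hj, hnone]
      rw [hσ.2] at this
      simp at this
  refine ⟨ofPred fun j => (σ j).1, fun B hB => ⟨?_, ?_⟩, ?_⟩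
  · obtain ⟨x, hx⟩ := Finpartition.nonempty_of_mem_parts _ hB
    have hmem : ∀ y, (ofPred fun j => (σ j).1).part y = (ofPred fun j => (σ j).1).part x →
        y ∈ B := by
      intro y hy
      rw [Finpartition.part_eq_of_mem _ hB hx] at hy
      exact (Finpartition.part_eq_iff_mem _ hB).1 hy
    have : ∃ y, y ≠ x ∧ y ∈ B := by
      cases hp : (σ x).1 with
      | none =>
        obtain ⟨l, hl⟩ := (hsucc x).2 ((hσ.1 x).1 hp)
        have h := (isArc_iff _).1 ((harc x l).2 hl)
        exact ⟨l, h.1.ne', hmem l h.2.1.symm⟩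
      | some i =>
        have h := (isArc_iff _).1 ((harc i x).2 hp)
        exact ⟨i, h.1.ne, hmem i h.2.1⟩
    obtain ⟨y, hyx, hy⟩ := this
    exact Finset.one_lt_card.2 ⟨y, hy, x, hx, hyx⟩
  -- The predecessor of `y` lies before the box of `y`; an `x < y` of the same block and box would
  -- lie strictly inside the arc ending at `y`.
  · have key : ∀ x ∈ B, ∀ y ∈ B, x < y → ∀ j, ¬ (x ∈ box n j ∧ y ∈ box n j) := by
      intro x hx y hy hxy j hj
      have hle := (exists_mem_box_iff n hxy).1 ⟨j, hj⟩
      have he : (ofPred fun j => (σ j).1).part x = (ofPred fun j => (σ j).1).part y := by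
        rw [Finpartition.part_eq_of_mem _ hB hx, Finpartition.part_eq_of_mem _ hB hy]
      obtain ⟨i, hi⟩ := exists_isArc_left hxy he
      have h1 := ((hσ.1 y).2 i ((harc i y).1 hi)).2
      exact ((isArc_iff _).1 hi).2.2 x he ⟨by rw [Fin.lt_def]; omega, hxy⟩
    intro x hx y hy hxy j hj
    rcases lt_or_gt_of_ne hxy with h | h
    · exact key x hx y hy h j hj
    · exact key y hy x hx h j hj.symm
  · funext j
    apply Prod.ext
    · ext i
      rw [history_fst, pred_eq_some, harc]
    · rw [Bool.eq_iff_iff, history_snd, ← hsucc]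
      simp only [harc]

end Bijection

/-! ### The statistics as sums over elements; proof of the algebraic identity. -/

section Weight

variable {N : ℕ} (π : SetPartition N)

open Classical in
lemma card_transients :
    tr π = (Finset.univ.filter fun j => (∃ i, IsArc π i j) ∧ ∃ l, IsArc π j l).card := by
  rw [tr]
  congr 1
  ext x
  simp only [Finset.mem_filter, Finset.mem_univ, true_and]
  constructor
  · rintro ⟨B, hB, hx, ⟨y, hy, hyx⟩, ⟨z, hz, hxz⟩⟩
    have hx' := π.part_eq_of_mem hB hx
    exact ⟨exists_isArc_left hyx ((π.part_eq_of_mem hB hy).trans hx'.symm),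
      exists_isArc_right hxz (hx'.trans (π.part_eq_of_mem hB hz).symm)⟩
  · rintro ⟨⟨i, hi⟩, ⟨l, hl⟩⟩
    rw [isArc_iff] at hi hl
    have hmem : ∀ y, π.part y = π.part x → y ∈ π.part x := fun y hy =>
      (π.mem_part_iff_part_eq_part (Finset.mem_univ _) (Finset.mem_univ _)).2 hy
    exact ⟨π.part x, by simp, hmem x rfl, ⟨i, hmem i hi.2.1, hi.1⟩, ⟨l, hmem l hl.2.1.symm, hl.1⟩⟩

-- Each block is counted at its greatest element, the one without outgoing arc.
open Classical in
lemma card_blocks : bl π = (Finset.univ.filter fun j => ∀ l, ¬ IsArc π j l).card := by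
  rw [bl]
  symm
  refine Finset.card_bij (fun j _ => π.part j) (fun j _ => by simp) ?_ ?_
  · intro i hi j hj h
    simp only [Finset.mem_filter, Finset.mem_univ, true_and] at hi hj
    rcases lt_trichotomy i j with hlt | heq | hlt
    · obtain ⟨l, hl⟩ := exists_isArc_right hlt h
      exact absurd hl (hi l)
    · exact heq
    · obtain ⟨l, hl⟩ := exists_isArc_right hlt h.symm
      exact absurd hl (hj l)
  · intro B hB
    have hne := π.nonempty_of_mem_parts hB
    refine ⟨B.max' hne, ?_, π.part_eq_of_mem hB (B.max'_mem hne)⟩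
    simp only [Finset.mem_filter, Finset.mem_univ, true_and]
    intro l hl
    rw [isArc_iff, π.part_eq_of_mem hB (B.max'_mem hne)] at hl
    exact absurd hl.1 (not_lt.2 (B.le_max' l ((π.part_eq_iff_mem hB).1 hl.2.1.symm)))

-- Crossings are grouped by the right end `j` of the arc that ends first; given the arc `(i, j)`,
-- the other arc is determined by its left end, an element greater than `i` that is open at `j`.
open Classical in
lemma card_crossings : cr π = ∑ j : Fin N, ((pred π j).elim 0 fun i =>
    ((openAt (history π) j).filter fun k => i < k).card) := by
  rw [cr, Finset.card_eq_sum_card_fiberwise (f := fun e => e.1.2) (t := Finset.univ)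
    (by intro; simp)]
  refine Finset.sum_congr rfl fun j _ => ?_
  cases h : pred π j with
  | none =>
    rw [pred_eq_none] at h
    simp only [Option.elim, Finset.card_eq_zero]
    ext e
    simp only [Finset.mem_filter, Finset.mem_univ, true_and, Finset.notMem_empty, iff_false]
    rintro ⟨⟨h1, -⟩, rfl⟩
    exact h _ h1
  | some i =>
    have hij := (pred_eq_some π).1 h
    simp only [Option.elim]
    refine Finset.card_bij (fun e _ => e.2.1) ?_ ?_ ?_
    · rintro ⟨⟨i', j'⟩, ⟨k, l⟩⟩ he
      simp only [Finset.mem_filter, Finset.mem_univ, true_and] at he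
      obtain ⟨⟨h1, h2, h3, h4, h5⟩, rfl⟩ := he
      obtain rfl := h1.left_unique hij
      simp only [Finset.mem_filter, mem_openAt_history]
      exact ⟨⟨h4, l, h2, le_of_lt h5⟩, h3⟩
    · rintro ⟨⟨i₁, j₁⟩, ⟨k₁, l₁⟩⟩ h₁ ⟨⟨i₂, j₂⟩, ⟨k₂, l₂⟩⟩ h₂ hk
      simp only [Finset.mem_filter, Finset.mem_univ, true_and] at h₁ h₂ hk
      obtain ⟨⟨a1, a2, -⟩, rfl⟩ := h₁
      obtain ⟨⟨b1, b2, -⟩, rfl⟩ := h₂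
      subst hk
      rw [a1.left_unique b1, a2.right_unique b2]
    · intro k hk
      simp only [Finset.mem_filter, mem_openAt_history] at hk
      obtain ⟨⟨h1, l, h2, h3⟩, h4⟩ := hk
      refine ⟨((i, j), (k, l)), ?_, rfl⟩
      simp only [Finset.mem_filter, Finset.mem_univ, true_and, and_true]
      refine ⟨hij, h2, h4, h1, lt_of_le_of_ne h3 ?_⟩
      rintro rfl
      exact absurd (hij.left_unique h2) h4.ne

variable {R : Type*} [CommRing R] (a b c q : R)

lemma weight_eq_prod {m : ℕ} {n : Fin m → ℕ} {π : SetPartition (∑ i, n i)}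
    (h : IsInhomogeneous n π) :
    weight a b c q π
      = ∏ j : Fin (∑ i, n i), chosenWeight a b q (openAt (history π) j) (history π j) := by
  classical
  have hsg : sg π = 0 := by
    rw [sg, Finset.card_eq_zero, Finset.filter_eq_empty_iff]
    intro B hB h1
    have := (h B hB).1
    omega
  have hfac : ∀ j : Fin (∑ i, n i), chosenWeight a b q (openAt (history π) j) (history π j)
      = (if ∀ l, ¬ IsArc π j l then a else 1)
        * (if (∃ i, IsArc π i j) ∧ ∃ l, IsArc π j l then b else 1)
        * q ^ ((pred π j).elim 0 fun i =>
          ((openAt (history π) j).filter fun k => i < k).card) := by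
    intro j
    rw [chosenWeight, history_fst]
    simp only [history_snd]
    cases hp : pred π j with
    | none =>
      rw [pred_eq_none] at hp
      have hl : ∃ l, IsArc π j l := (exists_isArc_of_isInhomogeneous h j).resolve_left
        fun ⟨i, hi⟩ => hp i hi
      simp only [Option.elim, pow_zero, mul_one]
      rw [if_neg (by simpa using hl), if_neg (by simpa using fun i hi => absurd hi (hp i)),
        mul_one]
    | some i =>
      have hi : ∃ i, IsArc π i j := ⟨i, (pred_eq_some π).1 hp⟩
      by_cases hl : ∃ l, IsArc π j l
      · have hl' : ¬ ∀ l, ¬ IsArc π j l := by simpa using hl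
        simp only [Option.elim, hl, hl', hi, and_self, if_true, if_false, one_mul]
      · have hl' : ∀ l, ¬ IsArc π j l := by simpa using hl
        simp only [Option.elim, if_neg hl, if_pos hl', hi, true_and, mul_one]
  rw [Finset.prod_congr rfl fun j _ => hfac j, Finset.prod_mul_distrib, Finset.prod_mul_distrib,
    Finset.prod_pow_eq_pow_sum, ← card_crossings, Finset.prod_ite, Finset.prod_ite]
  simp only [Finset.prod_const, one_pow, mul_one]
  rw [← card_blocks, ← card_transients, weight, hsg, pow_zero, mul_one]

lemma F_eq_transfer {m : ℕ} (n : Fin m → ℕ) :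
    F a b c q n = transfer a b q (currentStart n) (∑ i, n i) 0
      (∅ : Finset (Fin (∑ i, n i))) := by
  classical
  rw [← sum_valid_eq_transfer, F]
  refine Finset.sum_bij (fun π _ => history π) ?_ ?_ ?_ ?_
  · intro π hπ
    simpa using valid_history (Finset.mem_filter.1 hπ).2
  · intro π _ π' _ h
    exact history_injective h
  · intro σ hσ
    obtain ⟨π, h1, h2⟩ := exists_history_eq (Finset.mem_filter.1 hσ).2
    exact ⟨π, by simpa using h1, h2⟩
  · intro π hπ
    exact weight_eq_prod a b c q (Finset.mem_filter.1 hπ).2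

/-- The enumerative polynomial of inhomogeneous partitions is the value of the orthogonality
functional at a product of `q`-Charlier polynomials. -/
theorem F_eq_functional {a b c q : R} {L : Polynomial R →ₗ[R] R}
    (hL : IsOrthogonalityFunctional a b c q L) {m : ℕ} (n : Fin m → ℕ) :
    F a b c q n = L (∏ j, charlier a b c q (n j)) := by
  rw [F_eq_transfer, transfer_eq n hL]

end Weight

/-! ### Continuous `q`-Hermite and big `q`-Hermite polynomials. -/

section Hermite

variable {R : Type*} [CommRing R] (q α : R)

/-- The continuous `q`-Hermite polynomials in the variable `2 cos θ`. -/
noncomputable abbrev qHermite (n : ℕ) : Polynomial R := charlier (1 - q) 0 0 q n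

/-- The continuous big `q`-Hermite polynomials in the variable `2 cos θ`. -/
noncomputable abbrev bigQHermite (n : ℕ) : Polynomial R :=
  charlier (1 - q) (-α * (1 - q)) α q n

lemma X_mul_qHermite (n : ℕ) : Polynomial.X * qHermite q n
    = qHermite q (n + 1) + (1 - q ^ n) • qHermite q (n - 1) := by
  rw [X_mul_charlier, one_sub_mul_qInt]
  simp [Polynomial.smul_eq_C_mul]

lemma X_mul_bigQHermite (n : ℕ) : Polynomial.X * bigQHermite q α n
    = bigQHermite q α (n + 1) + (α * q ^ n) • bigQHermite q α n
      + (1 - q ^ n) • bigQHermite q α (n - 1) := by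
  rw [X_mul_charlier, one_sub_mul_qInt, mul_assoc, one_sub_mul_qInt]
  simp only [Polynomial.smul_eq_C_mul]
  congr 4
  ring

/-- The falling `q`-factorial `(1 - q ^ j) (1 - q ^ (j - 1)) ⋯` with `n` factors. -/
def qFalling (n j : ℕ) : R := ∏ i ∈ Finset.range n, (1 - q ^ (j - i))

lemma qFalling_eq_zero {n j : ℕ} (h : j < n) : qFalling q n j = 0 :=
  Finset.prod_eq_zero (Finset.mem_range.2 h) (by simp)

lemma qFalling_succ (n j : ℕ) : qFalling q (n + 1) j = qFalling q n j * (1 - q ^ (j - n)) :=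
  Finset.prod_range_succ _ _

lemma qFalling_succ_succ (n j : ℕ) :
    qFalling q (n + 1) (j + 1) = (1 - q ^ (j + 1)) * qFalling q n j := by
  rw [qFalling, Finset.prod_range_succ', mul_comm]
  simp [qFalling]

variable {q α}

/-- Mixed products allow an induction on `n` by moving `x` from one family to the other. For `j < n`
the value is zero, since `qFalling` then contains the factor `1 - q ^ 0`; the case `j = 0` is the
goal. -/
lemma apply_bigQHermite_mul_qHermite {L : Polynomial R →ₗ[R] R}
    (hL : ∀ j, L (qHermite q j) = α ^ j) (n : ℕ) : ∀ j,
    L (bigQHermite q α n * qHermite q j) = α ^ (j - n) * qFalling q n j := by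
  induction n using Nat.strong_induction_on with
  | _ n ih =>
    intro j
    match n with
    | 0 => simp [charlier, qFalling, hL]
    | n + 1 =>
      have hmul : bigQHermite q α (n + 1) * qHermite q j
          = bigQHermite q α n * qHermite q (j + 1)
            + (1 - q ^ j) • (bigQHermite q α n * qHermite q (j - 1))
            - (α * q ^ n) • (bigQHermite q α n * qHermite q j)
            - (1 - q ^ n) • (bigQHermite q α (n - 1) * qHermite q j) := by
        have h1 := X_mul_qHermite q j
        have h2 := X_mul_bigQHermite q α n
        simp only [Polynomial.smul_eq_C_mul] at h1 h2 ⊢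
        linear_combination bigQHermite q α n * h1 - qHermite q j * h2
      -- The term with `H_(j-1)` alone gives the claimed value; `hrest` shows that the other three
      -- cancel.
      have hmain : (1 - q ^ j) * (α ^ (j - 1 - n) * qFalling q n (j - 1))
          = α ^ (j - (n + 1)) * qFalling q (n + 1) j := by
        cases j with
        | zero => simp [qFalling_eq_zero q (Nat.succ_pos n)]
        | succ j => rw [qFalling_succ_succ, Nat.add_sub_cancel, Nat.add_sub_add_right]; ring
      have hrest : α ^ (j + 1 - n) * qFalling q n (j + 1)
          = α * q ^ n * (α ^ (j - n) * qFalling q n j)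
            + (1 - q ^ n) * (α ^ (j - (n - 1)) * qFalling q (n - 1) j) := by
        cases n with
        | zero => simp [qFalling, pow_succ']
        | succ n =>
          rw [qFalling_succ_succ, qFalling_succ, Nat.add_sub_cancel, Nat.add_sub_add_right]
          rcases lt_trichotomy j n with h | rfl | h
          · simp [qFalling_eq_zero q h]
          · simp
          · obtain ⟨d, rfl⟩ : ∃ d, j = n + 1 + d := ⟨j - (n + 1), by omega⟩
            rw [show n + 1 + d - n = d + 1 by omega, show n + 1 + d - (n + 1) = d by omega]
            ring
      rw [hmul]
      simp only [map_add, map_sub, map_smul, smul_eq_mul]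
      rw [ih n (by omega), ih n (by omega), ih n (by omega), ih (n - 1) (by omega)]
      linear_combination hmain + hrest

lemma apply_bigQHermite {L : Polynomial R →ₗ[R] R} (hL : ∀ j, L (qHermite q j) = α ^ j) (n : ℕ) :
    L (bigQHermite q α n) = if n = 0 then 1 else 0 := by
  have h := apply_bigQHermite_mul_qHermite hL n 0
  have h0 : qHermite q 0 = 1 := rfl
  rw [h0, mul_one] at h
  rw [h]
  split_ifs with hn
  · subst hn; simp [qFalling]
  · rw [qFalling_eq_zero q (by omega), mul_zero]

/-- Affine changes of variable act on the parameters. -/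
lemma eval_charlier_affine (a b c s t y : R) (n : ℕ) :
    (charlier (s ^ 2 * a) (s * b) (s * c + t) q n).eval (s * y + t)
      = s ^ n * (charlier a b c q n).eval y := by
  induction n using Nat.strong_induction_on with
  | _ n ih =>
    match n with
    | 0 => simp [charlier]
    | 1 => simp [charlier]; ring
    | n + 2 =>
      simp only [charlier, Polynomial.eval_sub, Polynomial.eval_mul, Polynomial.eval_X,
        Polynomial.eval_C]
      rw [ih n (by omega), ih (n + 1) (by omega)]
      ring

end Hermite

/-! ### `q`-factorials, their limit, and the norms of the `q`-Hermite polynomials. -/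

section QFactorial

variable (q : ℝ)

/-- The `q`-factorial `(q; q)_n`. -/
noncomputable def qPoch (n : ℕ) : ℝ := ∏ i ∈ Finset.range n, (1 - q ^ (i + 1))

lemma qPoch_succ (n : ℕ) : qPoch q (n + 1) = qPoch q n * (1 - q ^ (n + 1)) :=
  Finset.prod_range_succ _ _

variable {q}

lemma IsOrthogonalityFunctional.apply_qHermite_mul {L : Polynomial ℝ →ₗ[ℝ] ℝ}
    (hL : IsOrthogonalityFunctional (1 - q) 0 0 q L) (i j : ℕ) :
    L (qHermite q i * qHermite q j) = if i = j then qPoch q i else 0 := by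
  split_ifs with h
  · subst h
    induction i with
    | zero => simpa [charlier, qPoch] using hL.1
    | succ i ih =>
      have hmul : qHermite q (i + 1) * qHermite q (i + 1)
          = qHermite q i * qHermite q (i + 2) + (1 - q ^ (i + 1)) • (qHermite q i * qHermite q i)
            - (1 - q ^ i) • (qHermite q (i - 1) * qHermite q (i + 1)) := by
        have h1 := X_mul_qHermite q i
        have h2 := X_mul_qHermite q (i + 1)
        simp only [Polynomial.smul_eq_C_mul, Nat.add_sub_cancel] at h1 h2 ⊢
        linear_combination qHermite q i * h2 - qHermite q (i + 1) * h1
      rw [hmul]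
      simp only [map_add, map_sub, map_smul, smul_eq_mul]
      rw [ih, hL.2 i (i + 2) (by omega), hL.2 (i - 1) (i + 1) (by omega), qPoch_succ]
      ring
  · exact hL.2 i j h

variable (hq : |q| < 1)
include hq

lemma one_sub_pow_pos (n : ℕ) : 0 < 1 - q ^ (n + 1) := by
  have : |q ^ (n + 1)| < 1 := by
    rw [abs_pow]; exact pow_lt_one₀ (abs_nonneg q) hq (by omega)
  linarith [(abs_lt.1 this).2]

lemma qPoch_ne_zero (n : ℕ) : qPoch q n ≠ 0 :=
  Finset.prod_ne_zero_iff.2 fun i _ => (one_sub_pow_pos hq i).ne'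

lemma summable_abs_pow_succ : Summable fun k : ℕ => ‖-q ^ (k + 1)‖ := by
  simp only [norm_neg, norm_pow, Real.norm_eq_abs]
  exact (summable_nat_add_iff 1).2 (summable_geometric_of_lt_one (abs_nonneg q) hq)

lemma qPochInf_ne_zero : qPochInf q ≠ 0 := by
  have := tprod_one_add_ne_zero_of_summable (f := fun k : ℕ => -q ^ (k + 1))
    (fun k => by rw [← sub_eq_add_neg]; exact (one_sub_pow_pos hq k).ne')
    (summable_abs_pow_succ hq)
  simp only [← sub_eq_add_neg] at this
  exact this

lemma tendsto_qPoch : Filter.Tendsto (qPoch q) Filter.atTop (nhds (qPochInf q)) := by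
  have := (multipliable_one_add_of_summable (summable_abs_pow_succ hq)).hasProd.tendsto_prod_nat
  simp only [← sub_eq_add_neg] at this
  exact this

lemma exists_abs_inv_qPoch_le : ∃ C : ℝ, 0 < C ∧ ∀ n, |(qPoch q n)⁻¹| ≤ C := by
  obtain ⟨C, hC⟩ := ((tendsto_qPoch hq).inv₀ (qPochInf_ne_zero hq)).abs.bddAbove_range
  exact ⟨max C 1, by positivity, fun n => le_max_of_le_left (hC ⟨n, rfl⟩)⟩

end QFactorial

/-! ### The generating function of the `q`-Hermite polynomials as an infinite product. -/

section GeneratingFunction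

variable (q : ℝ)

/-- Sums over `k + l = n` with the coefficients of the Rogers–Szegő polynomials. -/
noncomputable def qConv (n : ℕ) (f : ℕ → ℕ → ℝ) : ℝ :=
  ∑ p ∈ Finset.HasAntidiagonal.antidiagonal n, (qPoch q p.1)⁻¹ * (qPoch q p.2)⁻¹ * f p.1 p.2

/-- The normalized continuous `q`-Hermite polynomial `H_n(cos θ) / (q; q)_n`. -/
noncomputable def hermiteFun (n : ℕ) (θ : ℝ) : ℝ :=
  qConv q n fun k l => Real.cos (((k : ℝ) - l) * θ)

/-- The generating function of the continuous `q`-Hermite polynomials. -/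
noncomputable def gen (β θ : ℝ) : ℝ := ∑' n, hermiteFun q n θ * β ^ n

/-- The squared modulus of the infinite product `∏ (1 - β q ^ k e ^ (i θ))`. -/
noncomputable def sqProd (β θ : ℝ) : ℝ :=
  ∏' k : ℕ, (1 - 2 * (β * q ^ k) * Real.cos θ + (β * q ^ k) ^ 2)

lemma qConv_add (n : ℕ) (f g : ℕ → ℕ → ℝ) :
    qConv q n (fun k l => f k l + g k l) = qConv q n f + qConv q n g := by
  simp only [qConv, mul_add, Finset.sum_add_distrib]

lemma qConv_sub (n : ℕ) (f g : ℕ → ℕ → ℝ) :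
    qConv q n (fun k l => f k l - g k l) = qConv q n f - qConv q n g := by
  simp only [qConv, mul_sub, Finset.sum_sub_distrib]

lemma qConv_const_mul (n : ℕ) (r : ℝ) (f : ℕ → ℕ → ℝ) :
    qConv q n (fun k l => r * f k l) = r * qConv q n f := by
  simp only [qConv, Finset.mul_sum]
  exact Finset.sum_congr rfl fun p _ => by ring

lemma qConv_congr {n : ℕ} {f g : ℕ → ℕ → ℝ} (h : ∀ k l, k + l = n → f k l = g k l) :
    qConv q n f = qConv q n g :=
  Finset.sum_congr rfl fun p hp => by rw [h p.1 p.2 (Finset.HasAntidiagonal.mem_antidiagonal.1 hp)]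

variable {q} (hq : |q| < 1)
include hq

lemma inv_qPoch_succ_mul (n : ℕ) : (qPoch q (n + 1))⁻¹ * (1 - q ^ (n + 1)) = (qPoch q n)⁻¹ := by
  have h1 := qPoch_ne_zero hq n
  have h2 := (one_sub_pow_pos hq n).ne'
  rw [qPoch_succ]
  field_simp

/-- The factor `1 - q ^ k` cancels the last factor of `(q; q)_k` and kills `k = 0`, so the index
shifts by one. -/
lemma qConv_one_sub_pow_left (n : ℕ) (f : ℕ → ℕ → ℝ) :
    qConv q (n + 1) (fun k l => (1 - q ^ k) * f k l) = qConv q n fun k l => f (k + 1) l := by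
  rw [qConv, Finset.Nat.sum_antidiagonal_succ, qConv]
  simp only [pow_zero, sub_self, zero_mul, mul_zero, zero_add]
  refine Finset.sum_congr rfl fun p _ => ?_
  rw [← inv_qPoch_succ_mul hq p.1]
  ring

lemma qConv_one_sub_pow_right (n : ℕ) (f : ℕ → ℕ → ℝ) :
    qConv q (n + 1) (fun k l => (1 - q ^ l) * f k l) = qConv q n fun k l => f k (l + 1) := by
  rw [qConv, Finset.Nat.sum_antidiagonal_succ', qConv]
  simp only [pow_zero, sub_self, zero_mul, mul_zero, zero_add]
  refine Finset.sum_congr rfl fun p _ => ?_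
  rw [← inv_qPoch_succ_mul hq p.2]
  ring

/-- The `q`-Pascal rule. -/
lemma qConv_succ (n : ℕ) (f : ℕ → ℕ → ℝ) :
    (1 - q ^ (n + 1)) * qConv q (n + 1) f
      = qConv q n fun k l => f (k + 1) l + q ^ k * f k (l + 1) := by
  rw [qConv_add, ← qConv_one_sub_pow_left hq,
    ← qConv_one_sub_pow_right hq n (fun k l => q ^ k * f k l), ← qConv_add, ← qConv_const_mul]
  refine qConv_congr q fun k l h => ?_
  rw [← h, pow_add]
  ring

lemma hermiteFun_one (θ : ℝ) : (1 - q) * hermiteFun q 1 θ = 2 * Real.cos θ := by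
  have h := qConv_succ hq 0 fun k l => Real.cos (((k : ℝ) - l) * θ)
  simp only [zero_add, pow_one] at h
  rw [hermiteFun, h]
  simp [qConv, qPoch]
  ring

lemma hermiteFun_succ_succ (n : ℕ) (θ : ℝ) : (1 - q ^ (n + 2)) * hermiteFun q (n + 2) θ
    = 2 * Real.cos θ * hermiteFun q (n + 1) θ - hermiteFun q n θ := by
  have h1 : hermiteFun q n θ = qConv q (n + 1)
      fun k l => (1 - q ^ k) * Real.cos (((k : ℝ) - l - 1) * θ) := by
    rw [qConv_one_sub_pow_left hq n fun k l => Real.cos (((k : ℝ) - l - 1) * θ), hermiteFun]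
    refine qConv_congr q fun k l _ => ?_
    push_cast
    congr 1
    ring
  rw [h1, hermiteFun, hermiteFun, qConv_succ hq, ← qConv_const_mul, ← qConv_sub]
  refine qConv_congr q fun k l _ => ?_
  have h2 : Real.cos ((((k + 1 : ℕ) : ℝ) - l) * θ) + Real.cos (((k : ℝ) - l - 1) * θ)
      = 2 * Real.cos θ * Real.cos (((k : ℝ) - l) * θ) := by
    push_cast
    rw [show ((k : ℝ) + 1 - l) * θ = ((k : ℝ) - l) * θ + θ by ring,
      show ((k : ℝ) - l - 1) * θ = ((k : ℝ) - l) * θ - θ by ring, Real.cos_add, Real.cos_sub]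
    ring
  have h3 : ((k : ℝ) - ((l + 1 : ℕ) : ℝ)) = (k : ℝ) - l - 1 := by push_cast; ring
  rw [h3]
  linear_combination h2

omit hq in
lemma hermiteFun_zero (θ : ℝ) : hermiteFun q 0 θ = 1 := by simp [hermiteFun, qConv, qPoch]

/-- Both sides obey the same three-term recurrence. This identifies the recursively defined
polynomials with explicit cosine sums, which can be integrated. -/
lemma eval_qHermite (n : ℕ) (θ : ℝ) :
    (qHermite q n).eval (2 * Real.cos θ) = qPoch q n * hermiteFun q n θ := by
  induction n using Nat.strong_induction_on with
  | _ n ih =>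
    match n with
    | 0 => simp [charlier, hermiteFun_zero, qPoch]
    | 1 =>
      have := hermiteFun_one hq θ
      simp [charlier, qPoch, this]
    | n + 2 =>
      have h := congrArg (Polynomial.eval (2 * Real.cos θ)) (X_mul_qHermite q (n + 1))
      simp only [Polynomial.eval_mul, Polynomial.eval_X, Polynomial.eval_add, Polynomial.eval_smul,
        Nat.add_sub_cancel, smul_eq_mul] at h
      rw [ih n (by omega), ih (n + 1) (by omega)] at h
      have h2 := hermiteFun_succ_succ hq n θ
      have e1 := qPoch_succ q n
      have e2 := qPoch_succ q (n + 1)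
      rw [e2]
      linear_combination -h - qPoch q (n + 1) * h2 + hermiteFun q n θ * e1

lemma exists_abs_hermiteFun_le :
    ∃ C : ℝ, 0 < C ∧ ∀ n θ, |hermiteFun q n θ| ≤ C * ((n : ℝ) + 1) := by
  obtain ⟨C, hC0, hC⟩ := exists_abs_inv_qPoch_le hq
  refine ⟨C * C, by positivity, fun n θ => ?_⟩
  have hterm : ∀ p ∈ Finset.HasAntidiagonal.antidiagonal n,
      |(qPoch q p.1)⁻¹ * (qPoch q p.2)⁻¹ * Real.cos (((p.1 : ℝ) - p.2) * θ)| ≤ C * C := by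
    intro p _
    rw [abs_mul, abs_mul]
    calc _ ≤ C * C * 1 := by gcongr; exacts [hC _, hC _, Real.abs_cos_le_one _]
      _ = _ := mul_one _
  refine (Finset.abs_sum_le_sum_abs _ _).trans ((Finset.sum_le_sum hterm).trans (le_of_eq ?_))
  simp [mul_comm]

omit hq in
lemma summable_succ_mul_pow {r : ℝ} (hr0 : 0 ≤ r) (hr : r < 1) (C : ℝ) :
    Summable fun n : ℕ => C * ((n : ℝ) + 1) * r ^ n := by
  have h1 := summable_pow_mul_geometric_of_norm_lt_one 1 (r := r)
    (by rwa [Real.norm_eq_abs, abs_of_nonneg hr0])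
  have h2 := (h1.add (summable_geometric_of_lt_one hr0 hr)).mul_left C
  refine h2.congr fun n => ?_
  simp
  ring

/-- A summable majorant of the generating function, uniform in `θ` and in `|β| ≤ r`. -/
lemma exists_gen_majorant {r : ℝ} (hr0 : 0 ≤ r) (hr : r < 1) : ∃ u : ℕ → ℝ, Summable u ∧
    ∀ n θ β, |β| ≤ r → ‖hermiteFun q n θ * β ^ n‖ ≤ u n := by
  obtain ⟨C, hC0, hC⟩ := exists_abs_hermiteFun_le hq
  refine ⟨_, summable_succ_mul_pow hr0 hr C, fun n θ β hβ => ?_⟩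
  rw [Real.norm_eq_abs, abs_mul, abs_pow]
  gcongr
  exact hC n θ

lemma summable_gen {β : ℝ} (hβ : |β| < 1) (θ : ℝ) :
    Summable fun n => hermiteFun q n θ * β ^ n := by
  obtain ⟨u, hu, h⟩ := exists_gen_majorant hq (abs_nonneg β) hβ
  exact hu.of_norm_bounded fun n => h n θ β le_rfl

omit hq in
lemma continuous_hermiteFun (n : ℕ) : Continuous (hermiteFun q n) := by
  unfold hermiteFun qConv
  fun_prop

lemma continuous_gen {β : ℝ} (hβ : |β| < 1) : Continuous (gen q β) := by
  obtain ⟨u, hu, h⟩ := exists_gen_majorant hq (abs_nonneg β) hβ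
  exact continuous_tsum (fun n => (continuous_hermiteFun n).mul continuous_const) hu
    fun n θ => h n θ β le_rfl

lemma continuousOn_gen {r : ℝ} (hr0 : 0 ≤ r) (hr : r < 1) (θ : ℝ) :
    ContinuousOn (fun β => gen q β θ) (Set.Icc (-r) r) := by
  obtain ⟨u, hu, h⟩ := exists_gen_majorant hq hr0 hr
  exact continuousOn_tsum (fun n => by fun_prop) hu fun n β hβ => h n θ β (abs_le.2 hβ)

lemma exists_abs_gen_le {r : ℝ} (hr0 : 0 ≤ r) (hr : r < 1) :
    ∃ C, ∀ θ β, |β| ≤ r → |gen q β θ| ≤ C := by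
  obtain ⟨u, hu, h⟩ := exists_gen_majorant hq hr0 hr
  exact ⟨∑' n, u n, fun θ β hβ => tsum_of_norm_bounded hu.hasSum fun n => h n θ β hβ⟩

/-- The three-term recurrence, multiplied by `β ^ (n + 2)` and summed, becomes this `q`-difference
equation; iterating it produces the infinite product. -/
lemma gen_mul_left {β : ℝ} (hβ : |β| < 1) (θ : ℝ) :
    gen q (q * β) θ = (1 - 2 * β * Real.cos θ + β ^ 2) * gen q β θ := by
  have hqβ : |q * β| < 1 := by
    rw [abs_mul]
    exact mul_lt_one_of_nonneg_of_lt_one_left (abs_nonneg _) hq hβ.le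
  have s1 := summable_gen hq hβ θ
  have s2 := summable_gen hq hqβ θ
  have e0 := hermiteFun_zero (q := q) θ
  have e1 := hermiteFun_one hq θ
  have t1 : gen q β θ = 1 + hermiteFun q 1 θ * β + ∑' n, hermiteFun q (n + 2) θ * β ^ (n + 2) := by
    rw [gen, ← s1.sum_add_tsum_nat_add 2]
    simp [Finset.sum_range_succ, e0]
  have t2 : gen q (q * β) θ = 1 + hermiteFun q 1 θ * (q * β)
      + ∑' n, hermiteFun q (n + 2) θ * (q * β) ^ (n + 2) := by
    rw [gen, ← s2.sum_add_tsum_nat_add 2]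
    simp [Finset.sum_range_succ, e0]
  have t3 : gen q β θ = 1 + ∑' n, hermiteFun q (n + 1) θ * β ^ (n + 1) := by
    rw [gen, ← s1.sum_add_tsum_nat_add 1]
    simp [e0]
  have r1 := (summable_nat_add_iff 1).2 s1
  have r2 := (summable_nat_add_iff 2).2 s1
  have key : ∑' n, hermiteFun q (n + 2) θ * (q * β) ^ (n + 2)
      = ∑' n, hermiteFun q (n + 2) θ * β ^ (n + 2)
        - 2 * Real.cos θ * β * ∑' n, hermiteFun q (n + 1) θ * β ^ (n + 1)
        + β ^ 2 * gen q β θ := by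
    rw [gen, ← tsum_mul_left, ← tsum_mul_left, ← r2.tsum_sub (r1.mul_left _),
      ← (r2.sub (r1.mul_left _)).tsum_add (s1.mul_left _)]
    refine tsum_congr fun n => ?_
    have := hermiteFun_succ_succ hq n θ
    rw [mul_pow]
    linear_combination (-β ^ (n + 2)) * this
  linear_combination t2 + key - t1 + 2 * Real.cos θ * β * t3 - β * e1

omit hq in
lemma gen_zero (θ : ℝ) : gen q 0 θ = 1 := by
  rw [gen, tsum_eq_single 0 fun n hn => by simp [hn]]
  simp [hermiteFun_zero]

lemma multipliable_sqProd (β θ : ℝ) :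
    Multipliable fun k : ℕ => 1 - 2 * (β * q ^ k) * Real.cos θ + (β * q ^ k) ^ 2 := by
  have hs : Summable fun k : ℕ => ‖-(2 * (β * q ^ k) * Real.cos θ) + (β * q ^ k) ^ 2‖ := by
    refine Summable.of_nonneg_of_le (fun _ => norm_nonneg _) (fun k => ?_)
      ((summable_geometric_of_lt_one (abs_nonneg q) hq).mul_left (2 * |β| + |β| ^ 2))
    have hk : |q| ^ k ≤ 1 := pow_le_one₀ (abs_nonneg q) hq.le
    have hk0 : 0 ≤ |q| ^ k := by positivity
    have hc := Real.abs_cos_le_one θ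
    calc ‖-(2 * (β * q ^ k) * Real.cos θ) + (β * q ^ k) ^ 2‖
        ≤ 2 * (|β| * |q| ^ k) * |Real.cos θ| + (|β| * |q| ^ k) ^ 2 := by
          refine (norm_add_le _ _).trans (le_of_eq ?_)
          simp
      _ ≤ 2 * (|β| * |q| ^ k) * 1 + |β| ^ 2 * (|q| ^ k * 1) := by
          rw [mul_pow, pow_two (|q| ^ k)]
          gcongr
      _ = _ := by ring
  refine (multipliable_one_add_of_summable hs).congr fun k => ?_
  ring

lemma tendsto_sqProd (β θ : ℝ) : Filter.Tendsto (fun N => ∏ k ∈ Finset.range N,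
    (1 - 2 * (β * q ^ k) * Real.cos θ + (β * q ^ k) ^ 2)) Filter.atTop (nhds (sqProd q β θ)) :=
  (multipliable_sqProd hq β θ).hasProd.tendsto_prod_nat

/-- The generating function is the reciprocal of an infinite product. -/
lemma sqProd_mul_gen {β : ℝ} (hβ : |β| < 1) (θ : ℝ) : sqProd q β θ * gen q β θ = 1 := by
  have hk : ∀ N : ℕ, |q ^ N * β| ≤ |β| := fun N => by
    rw [abs_mul, abs_pow]
    exact mul_le_of_le_one_left (abs_nonneg _) (pow_le_one₀ (abs_nonneg q) hq.le)
  have hN : ∀ N : ℕ, (∏ k ∈ Finset.range N,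
      (1 - 2 * (β * q ^ k) * Real.cos θ + (β * q ^ k) ^ 2)) * gen q β θ = gen q (q ^ N * β) θ := by
    intro N
    induction N with
    | zero => simp
    | succ N ih =>
      rw [Finset.prod_range_succ, mul_right_comm, ih,
        show q ^ (N + 1) * β = q * (q ^ N * β) by ring, gen_mul_left hq ((hk N).trans_lt hβ)]
      ring
  have hlim : Filter.Tendsto (fun N : ℕ => gen q (q ^ N * β) θ) Filter.atTop (nhds 1) := by
    have hc : ContinuousWithinAt (fun β => gen q β θ) (Set.Icc (-|β|) |β|) 0 :=
      continuousOn_gen hq (abs_nonneg β) hβ θ 0 (by simp)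
    have h0 : Filter.Tendsto (fun N : ℕ => q ^ N * β) Filter.atTop
        (nhdsWithin 0 (Set.Icc (-|β|) |β|)) := by
      refine tendsto_nhdsWithin_iff.2 ⟨?_, Filter.Eventually.of_forall fun N => abs_le.1 (hk N)⟩
      simpa using (tendsto_pow_atTop_nhds_zero_of_abs_lt_one hq).mul_const β
    have := hc.tendsto.comp h0
    rwa [gen_zero] at this
  refine tendsto_nhds_unique ((tendsto_sqProd hq β θ).mul_const _) ?_
  simpa only [hN] using hlim

lemma gen_ne_zero {β : ℝ} (hβ : |β| < 1) (θ : ℝ) : gen q β θ ≠ 0 :=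
  right_ne_zero_of_mul (by rw [sqProd_mul_gen hq hβ θ]; exact one_ne_zero)

lemma sqProd_eq_mul (β θ : ℝ) :
    sqProd q β θ = (1 - 2 * β * Real.cos θ + β ^ 2) * sqProd q (β * q) θ := by
  have h1 := (tendsto_sqProd hq β θ).comp (Filter.tendsto_add_atTop_nat 1)
  have h2 := (tendsto_sqProd hq (β * q) θ).const_mul (1 - 2 * β * Real.cos θ + β ^ 2)
  refine tendsto_nhds_unique h1 (h2.congr fun N => ?_)
  rw [Function.comp_apply, Finset.prod_range_succ', mul_comm]
  simp [pow_succ', mul_assoc]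

end GeneratingFunction

/-! ### A finite Jacobi triple product and the `q`-binomial theorem. -/

section Theta

variable (q : ℝ)

/-- The coefficients `(-1) ^ i q ^ (i (i - 1) / 2)` of a theta function. -/
noncomputable def thetaSeq (i : ℤ) : ℝ := (-1) ^ i * q ^ (i * (i - 1) / 2).toNat

/-- This is `thetaSeq (i + 1) = -q ^ i * thetaSeq i`, with negative powers cleared so that `q = 0`
is included. -/
lemma pow_mul_thetaSeq_succ {A B : ℕ} {i : ℤ} (h : (A : ℤ) + i = B) :
    q ^ A * thetaSeq q (i + 1) = -(q ^ B * thetaSeq q i) := by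
  have hnn : ∀ j : ℤ, 0 ≤ j * (j - 1) / 2 := fun j => by
    refine Int.ediv_nonneg ?_ (by norm_num)
    rcases le_or_gt j 0 with hj | hj
    · exact mul_nonneg_of_nonpos_of_nonpos hj (by omega)
    · exact mul_nonneg hj.le (by omega)
  have he : (i + 1) * (i + 1 - 1) / 2 = i * (i - 1) / 2 + i := by
    rw [show (i + 1) * (i + 1 - 1) = i * (i - 1) + i * 2 by ring,
      Int.add_mul_ediv_right _ _ (by norm_num)]
  have hexp : A + ((i + 1) * (i + 1 - 1) / 2).toNat = B + (i * (i - 1) / 2).toNat := by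
    have h1 := hnn i
    have h2 := hnn (i + 1)
    zify
    rw [Int.toNat_of_nonneg h1, Int.toNat_of_nonneg h2, he]
    omega
  rw [thetaSeq, thetaSeq, zpow_add_one₀ (by norm_num)]
  calc _ = -((-1) ^ i * q ^ (A + ((i + 1) * (i + 1 - 1) / 2).toNat)) := by rw [pow_add]; ring
    _ = _ := by rw [hexp, pow_add]; ring

/-- `1 / (q; q)_k`, extended by zero to negative `k`. -/
noncomputable def invQPoch (k : ℤ) : ℝ := if 0 ≤ k then (qPoch q k.toNat)⁻¹ else 0

/-- The coefficients of the finite theta product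
`∏_{k < M} (1 - q ^ k w) ∏_{0 < k ≤ N} (1 - q ^ k / w)`. -/
noncomputable def thetaCoeff (M N : ℕ) (i : ℤ) : ℝ :=
  thetaSeq q i * qPoch q (M + N) * invQPoch q (M - i) * invQPoch q (N + i)

lemma invQPoch_of_neg {k : ℤ} (hk : k < 0) : invQPoch q k = 0 := if_neg (by omega)

lemma invQPoch_natCast (n : ℕ) : invQPoch q n = (qPoch q n)⁻¹ := by simp [invQPoch]

variable {q} (hq : |q| < 1)
include hq

lemma invQPoch_natCast_sub_one (n : ℕ) :
    invQPoch q ((n : ℤ) - 1) = (1 - q ^ n) * invQPoch q n := by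
  cases n with
  | zero => simp [invQPoch]
  | succ n =>
    rw [show ((n + 1 : ℕ) : ℤ) - 1 = (n : ℤ) by push_cast; ring, invQPoch_natCast,
      invQPoch_natCast, ← inv_qPoch_succ_mul hq n]
    ring

/-- Multiplication of the finite theta product by `1 - q ^ M w`, read off at `w ^ i`. -/
lemma thetaCoeff_succ_left (M N : ℕ) (i : ℤ) :
    thetaCoeff q (M + 1) N i = thetaCoeff q M N i - q ^ M * thetaCoeff q M N (i - 1) := by
  simp only [thetaCoeff]
  rcases lt_or_ge ((M : ℤ) + 1 - i) 0 with h1 | h1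
  · rw [invQPoch_of_neg q (k := ((M + 1 : ℕ) : ℤ) - i) (by push_cast; omega),
      invQPoch_of_neg q (k := (M : ℤ) - i) (by omega),
      invQPoch_of_neg q (k := (M : ℤ) - (i - 1)) (by omega)]
    ring
  rcases lt_or_ge ((N : ℤ) + i) 0 with h2 | h2
  · rw [invQPoch_of_neg q (k := (N : ℤ) + i) h2,
      invQPoch_of_neg q (k := (N : ℤ) + (i - 1)) (by omega)]
    ring
  obtain ⟨p, hp⟩ := Int.eq_ofNat_of_zero_le h1
  obtain ⟨r, hr⟩ := Int.eq_ofNat_of_zero_le h2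
  have hsum : M + N + 1 = p + r := by omega
  have hd := pow_mul_thetaSeq_succ q (A := p) (B := M) (i := i - 1) (by omega)
  rw [sub_add_cancel] at hd
  rw [show ((M + 1 : ℕ) : ℤ) - i = p by push_cast; omega, show (M : ℤ) - i = p - 1 by omega,
    show (M : ℤ) - (i - 1) = p by omega, hr, show (N : ℤ) + (i - 1) = r - 1 by omega,
    invQPoch_natCast_sub_one hq, invQPoch_natCast_sub_one hq,
    show M + 1 + N = M + N + 1 by omega, qPoch_succ, hsum, pow_add]
  linear_combination qPoch q (M + N) * invQPoch q p * invQPoch q r * (1 - q ^ r) * hd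

lemma thetaCoeff_succ_right (M N : ℕ) (i : ℤ) :
    thetaCoeff q M (N + 1) i = thetaCoeff q M N i - q ^ (N + 1) * thetaCoeff q M N (i + 1) := by
  simp only [thetaCoeff]
  rcases lt_or_ge ((M : ℤ) - i) 0 with h1 | h1
  · rw [invQPoch_of_neg q (k := (M : ℤ) - i) h1,
      invQPoch_of_neg q (k := (M : ℤ) - (i + 1)) (by omega)]
    ring
  rcases lt_or_ge ((N : ℤ) + 1 + i) 0 with h2 | h2
  · rw [invQPoch_of_neg q (k := ((N + 1 : ℕ) : ℤ) + i) (by push_cast; omega),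
      invQPoch_of_neg q (k := (N : ℤ) + i) (by omega),
      invQPoch_of_neg q (k := (N : ℤ) + (i + 1)) (by omega)]
    ring
  obtain ⟨p, hp⟩ := Int.eq_ofNat_of_zero_le h1
  obtain ⟨r, hr⟩ := Int.eq_ofNat_of_zero_le h2
  have hsum : M + N + 1 = p + r := by omega
  have hd := pow_mul_thetaSeq_succ q (A := N + 1) (B := r) (i := i) (by push_cast; omega)
  rw [show ((N + 1 : ℕ) : ℤ) + i = r by push_cast; omega, show (N : ℤ) + i = r - 1 by omega,
    show (N : ℤ) + (i + 1) = r by omega, hp, show (M : ℤ) - (i + 1) = p - 1 by omega,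
    invQPoch_natCast_sub_one hq, invQPoch_natCast_sub_one hq,
    show M + (N + 1) = M + N + 1 by omega, qPoch_succ, hsum, pow_add q p r]
  linear_combination qPoch q (M + N) * invQPoch q p * invQPoch q r * (1 - q ^ p) * hd

lemma tendsto_invQPoch : Filter.Tendsto (invQPoch q) Filter.atTop (nhds (qPochInf q)⁻¹) := by
  have h : Filter.Tendsto Int.toNat Filter.atTop Filter.atTop :=
    Filter.tendsto_atTop.2 fun b => (Filter.eventually_ge_atTop (b : ℤ)).mono fun k hk => by omega
  refine (((tendsto_qPoch hq).inv₀ (qPochInf_ne_zero hq)).comp h).congr' ?_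
  filter_upwards [Filter.eventually_ge_atTop (0 : ℤ)] with k hk
  rw [Function.comp_apply, invQPoch, if_pos hk]

lemma tendsto_thetaCoeff (i : ℤ) : Filter.Tendsto (fun N => thetaCoeff q (N + 1) N i)
    Filter.atTop (nhds (thetaSeq q i * (qPochInf q)⁻¹)) := by
  have hcast : Filter.Tendsto (fun N : ℕ => (N : ℤ)) Filter.atTop Filter.atTop :=
    tendsto_natCast_atTop_atTop
  have h1 : Filter.Tendsto (fun N : ℕ => ((N + 1 : ℕ) : ℤ) - i) Filter.atTop Filter.atTop :=
    Filter.tendsto_atTop.2 fun b => (hcast.eventually_ge_atTop (b + i)).mono fun N hN => by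
      push_cast; omega
  have h2 : Filter.Tendsto (fun N : ℕ => (N : ℤ) + i) Filter.atTop Filter.atTop :=
    Filter.tendsto_atTop.2 fun b => (hcast.eventually_ge_atTop (b - i)).mono fun N hN => by omega
  have h3 : Filter.Tendsto (fun N : ℕ => N + 1 + N) Filter.atTop Filter.atTop :=
    Filter.tendsto_atTop.2 fun b => (Filter.eventually_ge_atTop b).mono fun N hN => by omega
  have hne := qPochInf_ne_zero hq
  have := ((((tendsto_qPoch hq).comp h3).const_mul (thetaSeq q i)).mul
    ((tendsto_invQPoch hq).comp h1)).mul ((tendsto_invQPoch hq).comp h2)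
  rw [mul_inv_cancel_right₀ hne] at this
  exact this

/-- Up to a factor the sum is the `q`-binomial expansion of `∏_{s < n} (1 - q ^ s z)` at the root `z
= q ^ (-i)`. The `q`-Pascal rule avoids the negative power: it reduces `(n + 1, i + 1)` to `(n, i)`
and gives a factor `1 - q ^ 0` at `i = 0`. -/
lemma qConv_thetaSeq (n : ℕ) : ∀ i : ℕ, i < n →
    qConv q n (fun k _ => thetaSeq q ((k : ℤ) - i)) = 0 := by
  induction n with
  | zero => intro i hi; omega
  | succ n ih =>
    intro i hi
    have hne := (one_sub_pow_pos hq n).ne'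
    have h := qConv_succ hq n fun k _ => thetaSeq q ((k : ℤ) - i)
    have h2 : (qConv q n fun k _ => thetaSeq q (((k + 1 : ℕ) : ℤ) - i)
        + q ^ k * thetaSeq q ((k : ℤ) - i))
        = (1 - q ^ i) * qConv q n fun k _ => thetaSeq q ((k : ℤ) - i + 1) := by
      rw [← qConv_const_mul]
      refine qConv_congr q fun k l _ => ?_
      have := pow_mul_thetaSeq_succ q (A := i) (B := k) (i := (k : ℤ) - i) (by omega)
      rw [show ((k + 1 : ℕ) : ℤ) - i = (k : ℤ) - i + 1 by push_cast; ring]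
      linear_combination this
    have h3 : (1 - q ^ i) * qConv q n (fun k _ => thetaSeq q ((k : ℤ) - i + 1)) = 0 := by
      cases i with
      | zero => simp
      | succ i =>
        have := ih i (by omega)
        rw [show (fun (k _ : ℕ) => thetaSeq q ((k : ℤ) - (i + 1 : ℕ) + 1))
          = fun (k _ : ℕ) => thetaSeq q ((k : ℤ) - i) by funext k _; congr 1; push_cast; ring,
          this, mul_zero]
    rw [h2, h3] at h
    exact (mul_eq_zero.1 h).resolve_left hne

end Theta

/-! ### Fourier coefficients of the `q`-Hermite weight. -/

section Fourier

variable (q : ℝ)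

/-- The partial products of the weight function of the continuous `q`-Hermite polynomials. -/
noncomputable def weightPartial (N : ℕ) (θ : ℝ) : ℝ :=
  ∏ k ∈ Finset.range N, (1 - 2 * (1 * q ^ k) * Real.cos (2 * θ) + (1 * q ^ k) ^ 2)

lemma continuous_weightPartial (N : ℕ) : Continuous (weightPartial q N) := by
  unfold weightPartial
  fun_prop

/-- The Fourier coefficients of the partial products. -/
noncomputable def weightFourier (N : ℕ) (j : ℤ) : ℝ :=
  ∫ θ in (0 : ℝ)..(2 * Real.pi), weightPartial q N θ * Real.cos (j * θ)

lemma weightFourier_zero (j : ℤ) : weightFourier q 0 j = if j = 0 then 2 * Real.pi else 0 := by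
  simp only [weightFourier, weightPartial, Finset.range_zero, Finset.prod_empty, one_mul]
  split_ifs with h
  · subst h; simp
  · have hj : (j : ℝ) ≠ 0 := by exact_mod_cast h
    rw [intervalIntegral.integral_comp_mul_left (fun x => Real.cos x) hj, integral_cos]
    have : Real.sin (j * (2 * Real.pi)) = 0 := by
      have := Real.sin_int_mul_pi (2 * j)
      push_cast at this
      rw [← this]
      ring_nf
    simp [this]

lemma weightFourier_succ (N : ℕ) (j : ℤ) : weightFourier q (N + 1) j
    = (1 + (q ^ N) ^ 2) * weightFourier q N j
      - q ^ N * (weightFourier q N (j + 2) + weightFourier q N (j - 2)) := by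
  have hint : ∀ j : ℤ, IntervalIntegrable (fun θ => weightPartial q N θ * Real.cos (j * θ))
      MeasureTheory.volume 0 (2 * Real.pi) := fun j =>
    ((continuous_weightPartial q N).mul (by fun_prop)).intervalIntegrable _ _
  simp only [weightFourier]
  rw [← intervalIntegral.integral_add (hint _) (hint _), ← intervalIntegral.integral_const_mul,
    ← intervalIntegral.integral_const_mul, ← intervalIntegral.integral_sub
      ((hint j).const_mul _) (((hint _).add (hint _)).const_mul _)]
  refine intervalIntegral.integral_congr fun θ _ => ?_
  have h1 : Real.cos (((j + 2 : ℤ) : ℝ) * θ) + Real.cos (((j - 2 : ℤ) : ℝ) * θ)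
      = 2 * Real.cos (2 * θ) * Real.cos (j * θ) := by
    push_cast
    rw [add_mul, sub_mul, Real.cos_add, Real.cos_sub]
    ring
  simp only [weightPartial, Finset.prod_range_succ]
  linear_combination (q ^ N * ∏ k ∈ Finset.range N,
    (1 - 2 * (1 * q ^ k) * Real.cos (2 * θ) + (1 * q ^ k) ^ 2)) * h1

lemma weightFourier_odd (N : ℕ) : ∀ i : ℤ, weightFourier q N (2 * i + 1) = 0 := by
  induction N with
  | zero => intro i; rw [weightFourier_zero, if_neg (by omega)]
  | succ N ih =>
    intro i
    have h1 := ih (i + 1)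
    have h2 := ih (i - 1)
    rw [show 2 * (i + 1) + 1 = 2 * i + 1 + 2 by ring] at h1
    rw [show 2 * (i - 1) + 1 = 2 * i + 1 - 2 by ring] at h2
    rw [weightFourier_succ, ih, h1, h2]
    ring

variable {q} (hq : |q| < 1)
include hq

/-- With `w = e ^ (2 i θ)` the partial product with `N + 1` factors is `1 - 1 / w` times the finite
theta product for `(N + 1, N)`; hence the difference of neighbouring coefficients. -/
lemma weightFourier_even (N : ℕ) : ∀ i : ℤ, weightFourier q (N + 1) (2 * i)
    = 2 * Real.pi * (thetaCoeff q (N + 1) N i - thetaCoeff q (N + 1) N (i + 1)) := by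
  induction N with
  | zero =>
    intro i
    have h0 : ∀ i : ℤ, weightFourier q 0 (2 * i) = 2 * Real.pi * thetaCoeff q 0 0 i := by
      intro i
      rw [weightFourier_zero]
      rcases lt_trichotomy i 0 with h | rfl | h
      · rw [if_neg (by omega), thetaCoeff, invQPoch_of_neg q (k := ((0 : ℕ) : ℤ) + i) (by simpa)]
        ring
      · simp [thetaCoeff, invQPoch, qPoch, thetaSeq]
      · rw [if_neg (by omega), thetaCoeff, invQPoch_of_neg q (k := ((0 : ℕ) : ℤ) - i) (by simpa)]
        ring
    rw [weightFourier_succ, show 2 * i + 2 = 2 * (i + 1) by ring,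
      show 2 * i - 2 = 2 * (i - 1) by ring, h0, h0, h0, thetaCoeff_succ_left hq,
      thetaCoeff_succ_left hq, add_sub_cancel_right]
    ring
  | succ N ih =>
    intro i
    rw [weightFourier_succ, show 2 * i + 2 = 2 * (i + 1) by ring,
      show 2 * i - 2 = 2 * (i - 1) by ring, ih, ih, ih]
    simp only [thetaCoeff_succ_left hq (N + 1) (N + 1), thetaCoeff_succ_right hq (N + 1) N,
      add_sub_cancel_right, sub_add_cancel]
    ring

/-- Each factor is at most `(1 + |q| ^ k) ^ 2 ≤ exp (2 |q| ^ k)`. The uniform bound justifies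
passing to the limit under the integral. -/
lemma exists_abs_weightPartial_le : ∃ C : ℝ, ∀ N θ, |weightPartial q N θ| ≤ C := by
  have hs := (summable_geometric_of_lt_one (abs_nonneg q) hq).mul_left 2
  refine ⟨Real.exp (∑' k : ℕ, 2 * |q| ^ k), fun N θ => ?_⟩
  rw [weightPartial, Finset.abs_prod]
  calc _ ≤ ∏ k ∈ Finset.range N, Real.exp (2 * |q| ^ k) := by
        refine Finset.prod_le_prod (fun _ _ => abs_nonneg _) fun k _ => ?_
        have h1 : |1 - 2 * (1 * q ^ k) * Real.cos (2 * θ) + (1 * q ^ k) ^ 2|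
            ≤ (1 + |q| ^ k) ^ 2 := by
          have hc := Real.abs_cos_le_one (2 * θ)
          have hk : |2 * (1 * q ^ k) * Real.cos (2 * θ)| ≤ 2 * |q| ^ k := by
            rw [abs_mul, abs_mul, one_mul, abs_pow, abs_two]
            exact mul_le_of_le_one_right (by positivity) hc
          have hk2 : (1 * q ^ k) ^ 2 = (|q| ^ k) ^ 2 := by
            rw [one_mul, ← abs_pow, sq_abs]
          rw [hk2]
          have := abs_le.1 hk
          rw [abs_le]
          constructor <;> nlinarith [sq_nonneg (|q| ^ k)]
        have h2 : 1 + |q| ^ k ≤ Real.exp (|q| ^ k) := by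
          linarith [Real.add_one_le_exp (|q| ^ k)]
        calc _ ≤ (1 + |q| ^ k) ^ 2 := h1
          _ ≤ Real.exp (|q| ^ k) ^ 2 := by gcongr
          _ = _ := by rw [← Real.exp_nat_mul]; norm_num
    _ = Real.exp (∑ k ∈ Finset.range N, 2 * |q| ^ k) := (Real.exp_sum _ _).symm
    _ ≤ _ := Real.exp_le_exp.2 (hs.sum_le_tsum _ fun _ _ => by positivity)

lemma tendsto_weightFourier (j : ℤ) : Filter.Tendsto (fun N => weightFourier q N j) Filter.atTop
    (nhds (∫ θ in (0 : ℝ)..(2 * Real.pi), sqProd q 1 (2 * θ) * Real.cos (j * θ))) := by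
  obtain ⟨C, hC⟩ := exists_abs_weightPartial_le hq
  refine intervalIntegral.tendsto_integral_filter_of_dominated_convergence (fun _ => C)
    (Filter.Eventually.of_forall fun N => ?_) (Filter.Eventually.of_forall fun N => ?_)
    intervalIntegrable_const ?_
  · exact ((continuous_weightPartial q N).mul (by fun_prop)).aestronglyMeasurable
  · refine Filter.Eventually.of_forall fun θ _ => ?_
    rw [Real.norm_eq_abs, abs_mul]
    calc _ ≤ |weightPartial q N θ| * 1 := by gcongr; exact Real.abs_cos_le_one _
      _ ≤ C := by rw [mul_one]; exact hC N θ
  · exact Filter.Eventually.of_forall fun θ _ => (tendsto_sqProd hq 1 (2 * θ)).mul_const _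

lemma integral_sqProd_mul_cos_odd (i : ℤ) :
    ∫ θ in (0 : ℝ)..(2 * Real.pi), sqProd q 1 (2 * θ) * Real.cos ((2 * i + 1 : ℤ) * θ) = 0 := by
  refine tendsto_nhds_unique (tendsto_weightFourier hq _) ?_
  simp only [weightFourier_odd]
  exact tendsto_const_nhds

lemma integral_sqProd_mul_cos_even (i : ℤ) :
    ∫ θ in (0 : ℝ)..(2 * Real.pi), sqProd q 1 (2 * θ) * Real.cos ((2 * i : ℤ) * θ)
      = 2 * Real.pi * (qPochInf q)⁻¹ * (thetaSeq q i - thetaSeq q (i + 1)) := by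
  refine tendsto_nhds_unique ((tendsto_weightFourier hq _).comp (Filter.tendsto_add_atTop_nat 1)) ?_
  have := ((tendsto_thetaCoeff hq i).sub (tendsto_thetaCoeff hq (i + 1))).const_mul (2 * Real.pi)
  rw [show 2 * Real.pi * (qPochInf q)⁻¹ * (thetaSeq q i - thetaSeq q (i + 1))
    = 2 * Real.pi * (thetaSeq q i * (qPochInf q)⁻¹ - thetaSeq q (i + 1) * (qPochInf q)⁻¹) by ring]
  refine this.congr fun N => ?_
  rw [Function.comp_apply, weightFourier_even hq]

lemma continuous_sqProd_one : Continuous fun θ => sqProd q 1 (2 * θ) := by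
  have h : ∀ φ, sqProd q q φ = (gen q q φ)⁻¹ := fun φ =>
    eq_inv_of_mul_eq_one_left (sqProd_mul_gen hq hq φ)
  have h2 := (continuous_gen hq hq).inv₀ (gen_ne_zero hq hq)
  simp only [sqProd_eq_mul hq 1, one_mul, h]
  have h3 : Continuous fun θ : ℝ => (gen q q (2 * θ))⁻¹ := h2.comp (by fun_prop)
  fun_prop

/-- For `n = 2 m` the frequencies are `2 (k - m)`, so the integral is a difference of two
alternating sums, which both vanish for `m > 0`; for odd `n` every frequency is odd. -/
lemma integral_sqProd_mul_hermiteFun (n : ℕ) :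
    ∫ θ in (0 : ℝ)..(2 * Real.pi), sqProd q 1 (2 * θ) * hermiteFun q n θ
      = if n = 0 then 4 * Real.pi * (qPochInf q)⁻¹ else 0 := by
  have hcont := continuous_sqProd_one hq
  have h1 : ∫ θ in (0 : ℝ)..(2 * Real.pi), sqProd q 1 (2 * θ) * hermiteFun q n θ
      = qConv q n fun k l => ∫ θ in (0 : ℝ)..(2 * Real.pi),
        sqProd q 1 (2 * θ) * Real.cos (((k : ℤ) - l : ℤ) * θ) := by
    simp only [hermiteFun, qConv, Finset.mul_sum, ← intervalIntegral.integral_const_mul]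
    rw [intervalIntegral.integral_finsetSum]
    · refine Finset.sum_congr rfl fun p _ => ?_
      congr 1
      funext θ
      push_cast
      ring
    · intro p _
      exact Continuous.intervalIntegrable (by fun_prop) _ _
  rw [h1]
  rcases Nat.even_or_odd' n with ⟨m, rfl | rfl⟩
  · have h2 : (qConv q (2 * m) fun k l => ∫ θ in (0 : ℝ)..(2 * Real.pi),
        sqProd q 1 (2 * θ) * Real.cos (((k : ℤ) - l : ℤ) * θ))
        = 2 * Real.pi * (qPochInf q)⁻¹ * (qConv q (2 * m) (fun k _ => thetaSeq q ((k : ℤ) - m))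
          - qConv q (2 * m) (fun k _ => thetaSeq q ((k : ℤ) - m + 1))) := by
      rw [← qConv_sub, ← qConv_const_mul]
      refine qConv_congr q fun k l h => ?_
      rw [show (k : ℤ) - l = 2 * ((k : ℤ) - m) by omega, integral_sqProd_mul_cos_even hq]
    rw [h2]
    cases m with
    | zero => simp [qConv, qPoch, thetaSeq]; ring
    | succ m =>
      rw [if_neg (by omega), qConv_thetaSeq hq _ (m + 1) (by omega),
        show (fun (k _ : ℕ) => thetaSeq q ((k : ℤ) - (m + 1 : ℕ) + 1))
          = fun (k _ : ℕ) => thetaSeq q ((k : ℤ) - m) by funext k _; congr 1; push_cast; ring,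
        qConv_thetaSeq hq _ m (by omega)]
      ring
  · rw [if_neg (by omega)]
    refine Finset.sum_eq_zero fun p hp => ?_
    beta_reduce
    have hp' := Finset.HasAntidiagonal.mem_antidiagonal.1 hp
    rw [show (p.1 : ℤ) - p.2 = 2 * ((p.1 : ℤ) - m - 1) + 1 by omega,
      integral_sqProd_mul_cos_odd hq, mul_zero]

end Fourier

/-! ### Moments of the big `q`-Hermite weight. -/

section Moments

variable (q : ℝ)

/-- The weight function of the continuous big `q`-Hermite polynomials on the circle. -/
noncomputable def circleWeight (β θ : ℝ) : ℝ :=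
  4 * (Real.sin θ ^ 2 / (1 - 2 * β * Real.cos θ + β ^ 2)) * gen q (q * β) θ * (gen q q (2 * θ))⁻¹

lemma quadratic_eq (β θ : ℝ) :
    1 - 2 * β * Real.cos θ + β ^ 2 = Real.sin θ ^ 2 + (Real.cos θ - β) ^ 2 := by
  linear_combination -Real.sin_sq_add_cos_sq θ

lemma quadratic_pos_of_abs_lt {β : ℝ} (hβ : |β| < 1) (θ : ℝ) :
    0 < 1 - 2 * β * Real.cos θ + β ^ 2 := by
  have hc := Real.abs_cos_le_one θ
  have h1 : β * Real.cos θ ≤ |β| := (le_abs_self _).trans (by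
    rw [abs_mul]; exact mul_le_of_le_one_right (abs_nonneg _) hc)
  have h2 : β ^ 2 = |β| ^ 2 := (sq_abs β).symm
  nlinarith [pow_pos (sub_pos.2 hβ) 2]

lemma quadratic_pos_of_sin_ne_zero (β : ℝ) {θ : ℝ} (hθ : Real.sin θ ≠ 0) :
    0 < 1 - 2 * β * Real.cos θ + β ^ 2 := by
  rw [quadratic_eq]; positivity

variable {q} (hq : |q| < 1)
include hq

lemma abs_mul_lt_one {β : ℝ} (hβ : |β| ≤ 1) : |q * β| < 1 := by
  rw [abs_mul]
  exact mul_lt_one_of_nonneg_of_lt_one_left (abs_nonneg _) hq hβ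

lemma sqProd_one_eq (θ : ℝ) : sqProd q 1 (2 * θ) = 4 * Real.sin θ ^ 2 * (gen q q (2 * θ))⁻¹ := by
  rw [sqProd_eq_mul hq, one_mul, eq_inv_of_mul_eq_one_left (sqProd_mul_gen hq hq (2 * θ)),
    Real.cos_two_mul, Real.cos_sq']
  ring

lemma circleWeight_eq {β : ℝ} (hβ : |β| < 1) (θ : ℝ) :
    circleWeight q β θ = sqProd q 1 (2 * θ) * gen q β θ := by
  have := (quadratic_pos_of_abs_lt hβ θ).ne'
  rw [circleWeight, sqProd_one_eq hq, gen_mul_left hq hβ]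
  field_simp

lemma measurable_circleWeight {β : ℝ} (hβ : |β| ≤ 1) : Measurable (circleWeight q β) := by
  have h1 := (continuous_gen hq (abs_mul_lt_one hq hβ)).measurable
  have h2 : Measurable fun θ => gen q q (2 * θ) :=
    ((continuous_gen hq hq).comp (continuous_const.mul continuous_id)).measurable
  unfold circleWeight
  fun_prop

/-- Only the factor `k = 0` of the denominator can vanish for `|β| = 1`. It is `sin ^ 2 θ + (cos θ -
β) ^ 2`, so `sin ^ 2 θ` from the numerator controls it, uniformly up to the boundary. -/
lemma exists_abs_circleWeight_le : ∃ C : ℝ, ∀ β, |β| ≤ 1 → ∀ θ ∈ Set.Icc 0 (2 * Real.pi),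
    |circleWeight q β θ| ≤ C := by
  obtain ⟨C₁, h₁⟩ := exists_abs_gen_le hq (abs_nonneg q) hq
  have hcont : Continuous fun θ => (gen q q (2 * θ))⁻¹ :=
    ((continuous_gen hq hq).comp (continuous_const.mul continuous_id)).inv₀
      fun θ => gen_ne_zero hq hq _
  obtain ⟨C₂, h₂⟩ := (isCompact_Icc (a := (0 : ℝ)) (b := 2 * Real.pi)).exists_bound_of_continuousOn
    hcont.continuousOn
  refine ⟨4 * 1 * C₁ * C₂, fun β hβ θ hθ => ?_⟩
  have hβ' : |q * β| ≤ |q| := by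
    rw [abs_mul]; exact mul_le_of_le_one_right (abs_nonneg _) hβ
  have hsin : |Real.sin θ ^ 2 / (1 - 2 * β * Real.cos θ + β ^ 2)| ≤ 1 := by
    rw [quadratic_eq, abs_of_nonneg (by positivity)]
    exact div_le_one_of_le₀ (by nlinarith [sq_nonneg (Real.cos θ - β)]) (by positivity)
  have hC₁ : 0 ≤ C₁ := (abs_nonneg _).trans (h₁ θ 0 (by simp))
  rw [circleWeight, abs_mul, abs_mul, abs_mul, abs_of_nonneg (by norm_num : (0 : ℝ) ≤ 4)]
  gcongr
  exacts [h₁ θ _ hβ', h₂ θ hθ]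

lemma intervalIntegrable_circleWeight {β : ℝ} (hβ : |β| ≤ 1) (p : Polynomial ℝ) :
    IntervalIntegrable (fun θ => p.eval (2 * Real.cos θ) * circleWeight q β θ)
      MeasureTheory.volume 0 (2 * Real.pi) := by
  obtain ⟨C, hC⟩ := exists_abs_circleWeight_le hq
  have hp : Continuous fun θ => p.eval (2 * Real.cos θ) := p.continuous.comp (by fun_prop)
  have h1 : IntervalIntegrable (circleWeight q β) MeasureTheory.volume 0 (2 * Real.pi) := by
    refine (intervalIntegrable_const (c := C)).mono_fun'
      (measurable_circleWeight hq hβ).aestronglyMeasurable ?_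
    rw [Set.uIoc_of_le (by positivity)]
    refine (MeasureTheory.ae_restrict_iff' measurableSet_Ioc).2 (Filter.Eventually.of_forall ?_)
    exact fun θ hθ => hC β hβ θ (Set.Ioc_subset_Icc_self hθ)
  exact h1.continuousOn_mul hp.continuousOn

/-- Integration against the normalized weight function, as a functional on polynomials in
`2 cos θ`. -/
noncomputable def momentFunctional {β : ℝ} (hβ : |β| ≤ 1) : Polynomial ℝ →ₗ[ℝ] ℝ where
  toFun p := qPochInf q / (4 * Real.pi)
    * ∫ θ in (0 : ℝ)..(2 * Real.pi), p.eval (2 * Real.cos θ) * circleWeight q β θ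
  map_add' p r := by
    simp only [Polynomial.eval_add, add_mul]
    rw [intervalIntegral.integral_add (intervalIntegrable_circleWeight hq hβ p)
      (intervalIntegrable_circleWeight hq hβ r), mul_add]
  map_smul' t p := by
    simp only [Polynomial.eval_smul, smul_eq_mul, mul_assoc, intervalIntegral.integral_const_mul,
      RingHom.id_apply]
    ring

lemma momentFunctional_apply {β : ℝ} (hβ : |β| ≤ 1) (p : Polynomial ℝ) :
    momentFunctional hq hβ p = qPochInf q / (4 * Real.pi)
      * ∫ θ in (0 : ℝ)..(2 * Real.pi), p.eval (2 * Real.cos θ) * circleWeight q β θ := rfl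

lemma momentFunctional_zero_qHermite (n : ℕ) :
    momentFunctional hq (β := 0) (by simp) (qHermite q n) = if n = 0 then 1 else 0 := by
  have h : ∀ θ, (qHermite q n).eval (2 * Real.cos θ) * circleWeight q 0 θ
      = qPoch q n * (sqProd q 1 (2 * θ) * hermiteFun q n θ) := fun θ => by
    rw [eval_qHermite hq, circleWeight_eq hq (by simp), gen_zero]
    ring
  have hne := qPochInf_ne_zero hq
  rw [momentFunctional_apply]
  simp only [h]
  rw [intervalIntegral.integral_const_mul, integral_sqProd_mul_hermiteFun hq]
  split_ifs with hn
  · subst hn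
    have := Real.pi_ne_zero
    simp only [qPoch, Finset.range_zero, Finset.prod_empty]
    field_simp
  · simp

lemma momentFunctional_zero_mul (i j : ℕ) :
    momentFunctional hq (β := 0) (by simp) (qHermite q i * qHermite q j)
      = if i = j then qPoch q i else 0 :=
  (isOrthogonalityFunctional_of_apply_charlier
    (momentFunctional_zero_qHermite hq)).apply_qHermite_mul i j

/-- The weight for `β` is the weight for `0` times `∑ H_n β ^ n / (q; q)_n`; integrating termwise
against `H_j` leaves `n = j`, whose norm `(q; q)_j` cancels the denominator. -/
lemma momentFunctional_qHermite_of_abs_lt {β : ℝ} (hβ : |β| < 1) (j : ℕ) :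
    momentFunctional hq hβ.le (qHermite q j) = β ^ j := by
  obtain ⟨u, hu, hbound⟩ := exists_gen_majorant hq (abs_nonneg β) hβ
  set B : ℝ → ℝ := fun θ => (qHermite q j).eval (2 * Real.cos θ) * sqProd q 1 (2 * θ) with hB
  have hBc : Continuous B :=
    ((qHermite q j).continuous.comp (by fun_prop)).mul (continuous_sqProd_one hq)
  have hsum : HasSum (fun n => ∫ θ in (0 : ℝ)..(2 * Real.pi),
      B θ * (hermiteFun q n θ * β ^ n)) (∫ θ in (0 : ℝ)..(2 * Real.pi), B θ * gen q β θ) := by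
    refine intervalIntegral.hasSum_integral_of_dominated_convergence (fun n θ => |B θ| * u n)
      (fun n => ?_) (fun n => ?_) ?_ ?_ ?_
    · exact (hBc.mul ((continuous_hermiteFun n).mul continuous_const)).aestronglyMeasurable
    · refine Filter.Eventually.of_forall fun θ _ => ?_
      rw [norm_mul, Real.norm_eq_abs (B θ)]
      gcongr
      exact hbound n θ β le_rfl
    · exact Filter.Eventually.of_forall fun θ _ => hu.mul_left _
    · simp only [tsum_mul_left]
      exact (hBc.abs.mul continuous_const).intervalIntegrable _ _
    · exact Filter.Eventually.of_forall fun θ _ => (summable_gen hq hβ θ).hasSum.mul_left _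
  have hterm : ∀ n, qPochInf q / (4 * Real.pi) * ∫ θ in (0 : ℝ)..(2 * Real.pi),
      B θ * (hermiteFun q n θ * β ^ n) = if n = j then β ^ j else 0 := by
    intro n
    have hne := qPoch_ne_zero hq n
    have h := momentFunctional_zero_mul hq j n
    rw [momentFunctional_apply] at h
    have he : ∀ θ, B θ * (hermiteFun q n θ * β ^ n) = (qPoch q n)⁻¹ * β ^ n *
        ((qHermite q j * qHermite q n).eval (2 * Real.cos θ) * circleWeight q 0 θ) := by
      intro θ
      rw [Polynomial.eval_mul, eval_qHermite hq n, circleWeight_eq hq (by simp), gen_zero, hB]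
      field_simp
    simp only [he]
    rw [intervalIntegral.integral_const_mul, mul_left_comm, h]
    by_cases hnj : n = j
    · subst hnj
      rw [if_pos rfl, if_pos rfl]
      field_simp
    · rw [if_neg (Ne.symm hnj), if_neg hnj, mul_zero]
  have h2 := hsum.mul_left (qPochInf q / (4 * Real.pi))
  simp only [hterm] at h2
  rw [momentFunctional_apply]
  simp only [circleWeight_eq hq hβ, ← mul_assoc]
  exact h2.unique (hasSum_ite_eq j (β ^ j))

/-- Dominated convergence; the integrand is continuous in `β` up to `±1` except where `sin θ = 0`, a
countable set. This covers the case `b ^ 2 = a (1 - q)`. -/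
lemma continuousOn_integral_circleWeight (p : Polynomial ℝ) :
    ContinuousOn (fun β => ∫ θ in (0 : ℝ)..(2 * Real.pi),
      p.eval (2 * Real.cos θ) * circleWeight q β θ) (Set.Icc (-1) 1) := by
  obtain ⟨C, hC⟩ := exists_abs_circleWeight_le hq
  have hp : Continuous fun θ => p.eval (2 * Real.cos θ) := p.continuous.comp (by fun_prop)
  have hsin : ∀ᵐ θ : ℝ, Real.sin θ ≠ 0 := by
    have hc : Set.Countable {θ : ℝ | Real.sin θ = 0} := by
      have : {θ : ℝ | Real.sin θ = 0} ⊆ Set.range fun n : ℤ => (n : ℝ) * Real.pi := fun θ hθ => by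
        obtain ⟨n, hn⟩ := Real.sin_eq_zero_iff.1 hθ
        exact ⟨n, hn⟩
      exact (Set.countable_range _).mono this
    exact hc.ae_notMem MeasureTheory.volume
  intro β₀ hβ₀
  have hev : ∀ᶠ β in nhdsWithin β₀ (Set.Icc (-1 : ℝ) 1), |β| ≤ 1 :=
    Filter.eventually_of_mem self_mem_nhdsWithin fun β hβ => abs_le.2 hβ
  refine intervalIntegral.continuousWithinAt_of_dominated_interval
    (bound := fun θ => |p.eval (2 * Real.cos θ)| * C) ?_ ?_ ?_ ?_
  · exact hev.mono fun β hβ =>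
      (hp.measurable.mul (measurable_circleWeight hq hβ)).aestronglyMeasurable
  · refine hev.mono fun β hβ => Filter.Eventually.of_forall fun θ hθ => ?_
    rw [Set.uIoc_of_le (by positivity)] at hθ
    rw [norm_mul, Real.norm_eq_abs]
    gcongr
    exact hC β hβ θ (Set.Ioc_subset_Icc_self hθ)
  · exact (hp.abs.mul continuous_const).intervalIntegrable _ _
  · filter_upwards [hsin] with θ hθ _
    have hg : ContinuousOn (fun β => gen q (q * β) θ) (Set.Icc (-1) 1) := by
      refine (continuousOn_gen hq (abs_nonneg q) hq θ).comp (by fun_prop) fun β hβ => ?_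
      rw [Set.mem_Icc, ← abs_le, abs_mul]
      exact mul_le_of_le_one_right (abs_nonneg _) (abs_le.2 hβ)
    have hd : ContinuousOn (fun β => Real.sin θ ^ 2 / (1 - 2 * β * Real.cos θ + β ^ 2))
        (Set.Icc (-1) 1) := by
      refine ContinuousOn.div (by fun_prop) (by fun_prop) fun β _ => ?_
      exact (quadratic_pos_of_sin_ne_zero β hθ).ne'
    have : ContinuousOn (fun β => p.eval (2 * Real.cos θ) * circleWeight q β θ)
        (Set.Icc (-1) 1) := by
      unfold circleWeight
      exact continuousOn_const.mul (((continuousOn_const.mul hd).mul hg).mul continuousOn_const)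
    exact this β₀ hβ₀

lemma momentFunctional_qHermite {β : ℝ} (hβ : |β| ≤ 1) (j : ℕ) :
    momentFunctional hq hβ (qHermite q j) = β ^ j := by
  have h : Set.EqOn (fun β => qPochInf q / (4 * Real.pi) * ∫ θ in (0 : ℝ)..(2 * Real.pi),
      (qHermite q j).eval (2 * Real.cos θ) * circleWeight q β θ) (fun β => β ^ j)
      (Set.Icc (-1) 1) := by
    refine Set.EqOn.of_subset_closure (s := Set.Ioo (-1) 1) (fun β hβ => ?_)
      (continuousOn_const.mul (continuousOn_integral_circleWeight hq _))
      (continuous_pow j).continuousOn Set.Ioo_subset_Icc_self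
      (by rw [closure_Ioo (by norm_num)])
    exact momentFunctional_qHermite_of_abs_lt hq (abs_lt.2 hβ) j
  exact h (abs_le.1 hβ)

/-- Orthogonality of the continuous big `q`-Hermite polynomials. -/
theorem momentFunctional_bigQHermite {β : ℝ} (hβ : |β| ≤ 1) (n : ℕ) :
    momentFunctional hq hβ (bigQHermite q β n) = if n = 0 then 1 else 0 :=
  apply_bigQHermite (momentFunctional_qHermite hq hβ) n

end Moments

/-! ### Reduction from the circle to `[0, π]`. -/

section Symmetry

variable {q : ℝ} (hq : |q| < 1)
include hq

/-- The coefficients are polynomials in `2 cos θ`, so the weight is invariant under `θ ↦ 2 π - θ`.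
-/
lemma gen_congr {θ θ' : ℝ} (h : Real.cos θ = Real.cos θ') (β : ℝ) :
    gen q β θ = gen q β θ' := by
  have hH : ∀ n, hermiteFun q n θ = hermiteFun q n θ' := fun n => by
    have h1 := eval_qHermite hq n θ
    rw [h, eval_qHermite hq n θ'] at h1
    exact (mul_left_cancel₀ (qPoch_ne_zero hq n) h1).symm
  simp only [gen, hH]

lemma circleWeight_two_pi_sub (β θ : ℝ) :
    circleWeight q β (2 * Real.pi - θ) = circleWeight q β θ := by
  have h1 : Real.cos (2 * Real.pi - θ) = Real.cos θ := Real.cos_two_pi_sub θ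
  have h2 : Real.cos (2 * (2 * Real.pi - θ)) = Real.cos (2 * θ) := by
    rw [Real.cos_two_mul, Real.cos_two_mul, h1]
  have h3 : Real.sin (2 * Real.pi - θ) ^ 2 = Real.sin θ ^ 2 := by
    rw [Real.sin_sq, Real.sin_sq, h1]
  rw [circleWeight, circleWeight, gen_congr hq h1, gen_congr hq h2, h1, h3]

lemma momentFunctional_eq_integral_pi {β : ℝ} (hβ : |β| ≤ 1) (p : Polynomial ℝ) :
    momentFunctional hq hβ p = qPochInf q / (2 * Real.pi)
      * ∫ θ in (0 : ℝ)..Real.pi, p.eval (2 * Real.cos θ) * circleWeight q β θ := by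
  have hint := intervalIntegrable_circleWeight hq hβ p
  have hpi := Real.pi_pos
  have h1 := hint.mono_set (c := 0) (d := Real.pi) (by
    rw [Set.uIcc_of_le hpi.le, Set.uIcc_of_le (by positivity)]
    exact Set.Icc_subset_Icc le_rfl (by linarith))
  have h2 := hint.mono_set (c := Real.pi) (d := 2 * Real.pi) (by
    rw [Set.uIcc_of_le (by linarith), Set.uIcc_of_le (by positivity)]
    exact Set.Icc_subset_Icc hpi.le le_rfl)
  have h3 := intervalIntegral.integral_comp_sub_left (a := 0) (b := Real.pi)
    (fun θ => p.eval (2 * Real.cos θ) * circleWeight q β θ) (2 * Real.pi)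
  simp only [circleWeight_two_pi_sub hq, Real.cos_two_pi_sub, sub_zero] at h3
  rw [show 2 * Real.pi - Real.pi = Real.pi by ring] at h3
  rw [momentFunctional_apply, ← intervalIntegral.integral_add_adjacent_intervals h1 h2, ← h3]
  field_simp
  ring

lemma sqProd_eq_div {β : ℝ} (hβ : |β| ≤ 1) (θ : ℝ) :
    sqProd q β θ = (1 - 2 * β * Real.cos θ + β ^ 2) * (gen q (q * β) θ)⁻¹ := by
  rw [sqProd_eq_mul hq, mul_comm β q,
    eq_inv_of_mul_eq_one_left (sqProd_mul_gen hq (abs_mul_lt_one hq hβ) θ)]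

lemma tprod_eq_circleWeight {β θ : ℝ} (hβ : |β| ≤ 1) (hθ : Real.sin θ ≠ 0) :
    ∏' k : ℕ, (1 - 2 * (1 * q ^ k) * Real.cos (2 * θ) + (1 * q ^ k) ^ 2)
      / (1 - 2 * (β * q ^ k) * Real.cos θ + (β * q ^ k) ^ 2) = circleWeight q β θ := by
  have hT := (quadratic_pos_of_sin_ne_zero β hθ).ne'
  have hg := gen_ne_zero hq (abs_mul_lt_one hq hβ) θ
  have hne : sqProd q β θ ≠ 0 := by
    rw [sqProd_eq_div hq hβ]
    exact mul_ne_zero hT (inv_ne_zero hg)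
  rw [(multipliable_sqProd hq 1 (2 * θ)).tprod_div₀ (multipliable_sqProd hq β θ) hne]
  change sqProd q 1 (2 * θ) / sqProd q β θ = _
  rw [sqProd_one_eq hq, sqProd_eq_div hq hβ, circleWeight]
  field_simp

end Symmetry

/-! ### From the angle to the support `[A₋, A₊]`; proof of the integral formula. -/

section ChangeOfVariables

variable {a b c q : ℝ} (ha : 0 < a) (hq2 : q < 1)

/-- The parameter of the continuous big `q`-Hermite polynomials that correspond to the
`q`-Charlier polynomials. -/
noncomputable def hermiteParam (a b q : ℝ) : ℝ := -b / √(a * (1 - q))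

/-- The point of the support with angle `θ`. -/
noncomputable def supportPoint (a b c q θ : ℝ) : ℝ :=
  √(a / (1 - q)) * (2 * Real.cos θ) + (c + b / (1 - q))

include ha hq2

lemma sqrt_mul_eq : √(a * (1 - q)) = √(a / (1 - q)) * (1 - q) := by
  have h : 0 < 1 - q := by linarith
  rw [show a * (1 - q) = a / (1 - q) * (1 - q) ^ 2 by field_simp, Real.sqrt_mul (by positivity),
    Real.sqrt_sq h.le]

lemma abs_hermiteParam_le (hb : b ^ 2 ≤ a * (1 - q)) : |hermiteParam a b q| ≤ 1 := by
  have h : 0 < a * (1 - q) := mul_pos ha (by linarith)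
  rw [hermiteParam, abs_div, abs_neg, abs_of_nonneg (Real.sqrt_nonneg _),
    div_le_one (Real.sqrt_pos.2 h)]
  exact Real.abs_le_sqrt hb

lemma v₁_supportPoint (θ : ℝ) : v₁ a b c q (supportPoint a b c q θ) = Real.cos θ := by
  have h : 0 < 1 - q := by linarith
  have hs : 0 < √(a / (1 - q)) := Real.sqrt_pos.2 (by positivity)
  rw [v₁, supportPoint, show (1 - q) / a = (a / (1 - q))⁻¹ by rw [inv_div], Real.sqrt_inv]
  field_simp
  ring

lemma u₁_eq (x : ℝ) : u₁ a b c q x = 2 * v₁ a b c q x ^ 2 - 1 := by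
  have h : 0 < 1 - q := by linarith
  rw [v₁, mul_pow, mul_pow, Real.sq_sqrt (by positivity), u₁]
  field_simp
  ring

lemma density_supportPoint (hq1 : -1 < q) (hb : b ^ 2 ≤ a * (1 - q)) {θ : ℝ}
    (hθ : θ ∈ Set.Ioo 0 Real.pi) :
    density a b c q (supportPoint a b c q θ) = qPochInf q / (2 * Real.pi) * (1 / 2)
      * (√(a / (1 - q)))⁻¹ * circleWeight q (hermiteParam a b q) θ / Real.sin θ := by
  have h : 0 < 1 - q := by linarith
  have hsin : 0 < Real.sin θ := Real.sin_pos_of_pos_of_lt_pi hθ.1 hθ.2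
  have hpos : 0 < a * (1 - q) := mul_pos ha h
  rw [density, ← tprod_eq_circleWeight (abs_lt.2 ⟨hq1, hq2⟩) (abs_hermiteParam_le ha hq2 hb)
    hsin.ne', u₁_eq ha hq2, v₁_supportPoint ha hq2, ← Real.cos_two_mul, ← Real.sin_sq,
    Real.sqrt_sq hsin.le, ← Real.sqrt_inv, inv_div]
  congr 3
  funext k
  have hsq : √(a * (1 - q)) ^ 2 = a * (1 - q) := Real.sq_sqrt hpos.le
  congr 1
  · ring
  · rw [hermiteParam, mul_pow, div_pow, hsq]
    ring

lemma image_supportPoint :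
    supportPoint a b c q '' Set.Ioo 0 Real.pi = Set.Ioo (Aminus a b c q) (Aplus a b c q) := by
  have h : 0 < 1 - q := by linarith
  have hs : 0 < √(a / (1 - q)) := Real.sqrt_pos.2 (by positivity)
  ext x
  constructor
  · rintro ⟨θ, hθ, rfl⟩
    have h1 : Real.cos θ < 1 := by
      have := Real.cos_lt_cos_of_nonneg_of_le_pi le_rfl hθ.2.le hθ.1
      rwa [Real.cos_zero] at this
    have h2 : -1 < Real.cos θ := by
      have := Real.cos_lt_cos_of_nonneg_of_le_pi hθ.1.le le_rfl hθ.2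
      rwa [Real.cos_pi] at this
    rw [supportPoint, Aminus, Aplus]
    constructor <;> nlinarith
  · rintro ⟨h1, h2⟩
    rw [Aminus] at h1
    rw [Aplus] at h2
    set y := (x - (c + b / (1 - q))) / (2 * √(a / (1 - q))) with hy
    have hy1 : -1 < y := by rw [hy, lt_div_iff₀ (by positivity)]; linarith
    have hy2 : y < 1 := by rw [hy, div_lt_iff₀ (by positivity)]; linarith
    refine ⟨Real.arccos y, ⟨Real.arccos_pos.2 hy2, ?_⟩, ?_⟩
    · refine lt_of_le_of_ne (Real.arccos_le_pi y) fun he => ?_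
      have := Real.cos_arccos hy1.le hy2.le
      rw [he, Real.cos_pi] at this
      linarith
    · rw [supportPoint, Real.cos_arccos hy1.le hy2.le, hy]
      field_simp
      ring

omit ha hq2 in
lemma hasDerivAt_supportPoint (θ : ℝ) :
    HasDerivAt (supportPoint a b c q) (√(a / (1 - q)) * (2 * -Real.sin θ)) θ :=
  (((Real.hasDerivAt_cos θ).const_mul 2).const_mul _).add_const _

lemma injOn_supportPoint : Set.InjOn (supportPoint a b c q) (Set.Ioo 0 Real.pi) := by
  have h : 0 < 1 - q := by linarith
  have hs : 0 < √(a / (1 - q)) := Real.sqrt_pos.2 (by positivity)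
  intro x hx y hy hxy
  rw [supportPoint, supportPoint] at hxy
  have : Real.cos x = Real.cos y := by
    have := mul_left_cancel₀ hs.ne' (add_right_cancel hxy)
    linarith
  exact Real.injOn_cos (Set.Ioo_subset_Icc_self hx) (Set.Ioo_subset_Icc_self hy) this

omit ha hq2 in
lemma Aminus_le_Aplus : Aminus a b c q ≤ Aplus a b c q := by
  have := Real.sqrt_nonneg (a / (1 - q))
  rw [Aminus, Aplus]
  linarith

/-- The affine substitution that carries `2 cos θ` to the point of the support. -/
noncomputable def supportSubst (a b c q : ℝ) : Polynomial ℝ :=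
  Polynomial.C √(a / (1 - q)) * Polynomial.X + Polynomial.C (c + b / (1 - q))

omit ha hq2 in
lemma eval_comp_supportSubst (p : Polynomial ℝ) (θ : ℝ) :
    (p.comp (supportSubst a b c q)).eval (2 * Real.cos θ) = p.eval (supportPoint a b c q θ) := by
  simp [supportSubst, supportPoint]

/-- The Jacobian `2 √(a / (1 - q)) sin θ` cancels both `1 / √(1 - v₁ ^ 2) = 1 / sin θ` and the
prefactor of the density. -/
lemma deriv_smul_density (hq1 : -1 < q) (hb : b ^ 2 ≤ a * (1 - q)) (p : Polynomial ℝ) {θ : ℝ}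
    (hθ : θ ∈ Set.Ioo 0 Real.pi) :
    |√(a / (1 - q)) * (2 * -Real.sin θ)|
        • (p.eval (supportPoint a b c q θ) * density a b c q (supportPoint a b c q θ))
      = qPochInf q / (2 * Real.pi) * ((p.comp (supportSubst a b c q)).eval (2 * Real.cos θ)
        * circleWeight q (hermiteParam a b q) θ) := by
  have h : 0 < 1 - q := by linarith
  have hs : 0 < √(a / (1 - q)) := Real.sqrt_pos.2 (by positivity)
  have hsin : 0 < Real.sin θ := Real.sin_pos_of_pos_of_lt_pi hθ.1 hθ.2
  rw [density_supportPoint ha hq2 hq1 hb hθ, eval_comp_supportSubst, mul_neg, mul_neg, abs_neg,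
    abs_of_pos (by positivity), smul_eq_mul]
  field_simp

lemma intervalIntegrable_density (hq1 : -1 < q) (hb : b ^ 2 ≤ a * (1 - q)) (p : Polynomial ℝ) :
    IntervalIntegrable (fun x => p.eval x * density a b c q x) MeasureTheory.volume
      (Aminus a b c q) (Aplus a b c q) := by
  rw [intervalIntegrable_iff_integrableOn_Ioo_of_le (Aminus_le_Aplus),
    ← image_supportPoint ha hq2, MeasureTheory.integrableOn_image_iff_integrableOn_abs_deriv_smul
      measurableSet_Ioo (fun θ _ => (hasDerivAt_supportPoint θ).hasDerivWithinAt)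
      (injOn_supportPoint ha hq2),
    MeasureTheory.integrableOn_congr_fun
      (fun θ hθ => deriv_smul_density ha hq2 hq1 hb p hθ) measurableSet_Ioo]
  have hint := intervalIntegrable_circleWeight (abs_lt.2 ⟨hq1, hq2⟩)
    (abs_hermiteParam_le ha hq2 hb) (p.comp (supportSubst a b c q))
  have hpi := Real.pi_pos
  rw [intervalIntegrable_iff_integrableOn_Ioo_of_le (by positivity)] at hint
  exact (hint.mono_set (Set.Ioo_subset_Ioo le_rfl (by linarith))).const_mul _

lemma L₁_eval (hq1 : -1 < q) (hb : b ^ 2 ≤ a * (1 - q)) (p : Polynomial ℝ) :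
    L₁ a b c q (fun x => p.eval x)
      = momentFunctional (abs_lt.2 ⟨hq1, hq2⟩) (abs_hermiteParam_le ha hq2 hb)
        (p.comp (supportSubst a b c q)) := by
  rw [L₁, intervalIntegral.integral_of_le (Aminus_le_Aplus),
    MeasureTheory.integral_Ioc_eq_integral_Ioo, ← image_supportPoint ha hq2,
    MeasureTheory.integral_image_eq_integral_abs_deriv_smul
      measurableSet_Ioo (fun θ _ => (hasDerivAt_supportPoint θ).hasDerivWithinAt)
      (injOn_supportPoint ha hq2),
    MeasureTheory.setIntegral_congr_fun measurableSet_Ioo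
      (fun θ hθ => deriv_smul_density ha hq2 hq1 hb p hθ), MeasureTheory.integral_const_mul,
    momentFunctional_eq_integral_pi, intervalIntegral.integral_of_le Real.pi_pos.le,
    MeasureTheory.integral_Ioc_eq_integral_Ioo]

lemma charlier_comp_supportSubst (n : ℕ) :
    (charlier a b c q n).comp (supportSubst a b c q)
      = √(a / (1 - q)) ^ n • bigQHermite q (hermiteParam a b q) n := by
  have h : 0 < 1 - q := by linarith
  have hs : 0 < √(a / (1 - q)) := Real.sqrt_pos.2 (by positivity)
  refine Polynomial.funext fun y => ?_
  rw [Polynomial.eval_smul, smul_eq_mul, ← eval_charlier_affine _ _ _ _ (c + b / (1 - q))]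
  -- Scale, parameter and shift are matched so that the affine rule for `charlier` produces exactly
  -- `a`, `b`, `c`.
  have e1 : √(a / (1 - q)) ^ 2 * (1 - q) = a := by
    rw [Real.sq_sqrt (by positivity)]; field_simp
  have e2 : √(a / (1 - q)) * (-hermiteParam a b q * (1 - q)) = b := by
    rw [hermiteParam, sqrt_mul_eq ha hq2]; field_simp
  have e3 : √(a / (1 - q)) * hermiteParam a b q + (c + b / (1 - q)) = c := by
    rw [hermiteParam, sqrt_mul_eq ha hq2]; field_simp; ring
  rw [e1, e2, e3]
  simp [supportSubst]

/-- The enumerative polynomial of inhomogeneous partitions as an integral. -/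
theorem F_eq_L₁ (hq1 : -1 < q) (hb : b ^ 2 ≤ a * (1 - q)) {m : ℕ} (n : Fin m → ℕ) :
    F a b c q n = L₁ a b c q (fun x => ∏ j, (charlier a b c q (n j)).eval x) := by
  set M := momentFunctional (abs_lt.2 ⟨hq1, hq2⟩) (abs_hermiteParam_le ha hq2 hb) with hM
  have hΛ : IsOrthogonalityFunctional a b c q
      (M ∘ₗ (Polynomial.aeval (supportSubst a b c q)).toLinearMap) := by
    refine isOrthogonalityFunctional_of_apply_charlier fun n => ?_
    change M ((charlier a b c q n).comp (supportSubst a b c q)) = _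
    rw [charlier_comp_supportSubst ha hq2, map_smul, hM, momentFunctional_bigQHermite]
    split_ifs with hn
    · simp [hn]
    · simp
  rw [F_eq_functional hΛ n]
  simp only [← Polynomial.eval_prod]
  rw [L₁_eval ha hq2 hq1 hb]
  rfl

end ChangeOfVariables

end QCharlier

theorem mainTheorem2 :
    -- any commutative ring of parameters, `L` the orthogonality functional
    (∀ (R : Type*) [CommRing R] (a b c q : R),
      (∃! L : Polynomial R →ₗ[R] R, QCharlier.IsOrthogonalityFunctional a b c q L) ∧
      ∀ L : Polynomial R →ₗ[R] R, QCharlier.IsOrthogonalityFunctional a b c q L →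
        ∀ (m : ℕ) (n : Fin m → ℕ), 1 ≤ m →
          QCharlier.F a b c q n = L (∏ j, QCharlier.charlier a b c q (n j))) ∧
    -- real parameters, `L₁` the explicit integral
    (∀ a b c q : ℝ, 0 < a → -1 < q → q < 1 → b ^ 2 ≤ a * (1 - q) →
      (∀ p : Polynomial ℝ, IntervalIntegrable
        (fun x => p.eval x * QCharlier.density a b c q x) MeasureTheory.volume
        (QCharlier.Aminus a b c q) (QCharlier.Aplus a b c q)) ∧
      ∀ (m : ℕ) (n : Fin m → ℕ), 1 ≤ m →
        QCharlier.F a b c q n =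
          QCharlier.L₁ a b c q
            (fun x => ∏ j, (QCharlier.charlier a b c q (n j)).eval x)) := by
  refine ⟨fun R _ a b c q => ⟨QCharlier.existsUnique_isOrthogonalityFunctional a b c q,
    fun L hL m n _ => QCharlier.F_eq_functional hL n⟩, fun a b c q ha hq1 hq2 hb => ⟨fun p =>
      QCharlier.intervalIntegrable_density ha hq2 hq1 hb p, fun m n _ =>
        QCharlier.F_eq_L₁ ha hq2 hq1 hb n⟩⟩
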